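/- **Definitions.** A *program* is a finite set $P$ of commands $(s,c,c',m,s')$ with $s,s'\in\omega$, $c,c',m\in\{0,1\}$, such that (i) if $P$ contains a command with state $s$ and symbol $c$, then it contains a command with state $s$ and symbol $1-c$, and (ii) a command of $P$ is determined by its state $s$ and its symbol $c$. Let $\mathrm{states}(P)$ be the set of the first components of the commands of $P$. An *ordinal computation* by $P$ with input $T(0):\mathrm{Ord}\to 2$ is a triple $S:\theta\to\omega$, $H:\theta\to\mathrm{Ord}$, $T:\theta\to({}^{\mathrm{Ord}}2)$, where $\theta$ is a successor ordinal or $\theta=\mathrm{Ord}$, such that: - $S(0)=H(0)=0$; - if $t<\theta$ and $S(t)\notin\mathrm{states}(P)$, then $\theta=t+1$; - if $t<\theta$ and $S(t)\in\mathrm{states}(P)$, then $t+1<\theta$ and, for the unique $(s,c,c',m,s')\in P$ with $S(t)=s$ and $T(t)_{H(t)}=c$: $T(t+1)_{H(t)}=c'$, $T(t+1)_\xi=T(t)_\xi$ for $\xi\neq H(t)$, $S(t+1)=s'$, and $H(t+1)=H(t)+1$ if $m=1$, $H(t+1)=H(t)-1$ if $m=0$ and $H(t)$ is a successor ordinal,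 $H(t+1)=0$ otherwise; - if $t<\theta$ is a limit ordinal, then $T(t)_\xi=\liminf_{r\to t}T(r)_\xi$ for all $\xi$, $S(t)=\liminf_{r\to t}S(r)$ and $H(t)=\liminf_{r\to t,\,S(r)=S(t)}H(r)$. If $\theta=\beta+1$ is a successor ordinal, the computation *stops*, and one writes $P:T(0)\mapsto T(\beta)$. For $x\subseteq\mathrm{Ord}$ let $\chi_x:\mathrm{Ord}\to2$ be its characteristic function. For a class $M$, these notions *in $(M,\in)$* are the relativizations of the definitions to $M$, where the classes of $(M,\in)$, in particular the components $\theta,S,H,T$ of a computation in $(M,\in)$, are the classes definable over $(M,\in)$ with parameters from $M$. **Lemma.** Let $(M,\in)$ be a transitive model (a set or a class) of $\mathrm{ZF}^-$, i.e., of Zermelo–Fraenkel set theory without the power set axiom, and let $P$ be a program. Let $T(0):\mathrm{Ord}\to2$ be an initial tape content such that $T(0)\upharpoonright(\mathrm{Ord}\cap M)$ is definable in $(M,\in)$ with parameters from $M$, and let $S:\theta\to\omega$, $H:\theta\to\mathrm{Ord}$, $T:\theta\to({}^{\mathrm{Ord}}2)$ be the ordinal computation by $P$ with input $T(0)$. Then: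 (a) The ordinal computation by $P$ with input $T(0)$ is absolute for $(M,\in)$ below $\mathrm{Ord}\cap M$: the functions $S\upharpoonright(\theta\cap M)$ and $H\upharpoonright(\theta\cap M)$, together with $\bar T:\theta\cap M\to({}^{\mathrm{Ord}\cap M}2)$, $\bar T(t)=T(t)\upharpoonright(\mathrm{Ord}\cap M)$, form the (unique) ordinal computation by $P$ with input $T(0)\upharpoonright(\mathrm{Ord}\cap M)$ as computed in $(M,\in)$. (b) If $\mathrm{Ord}\subseteq M$, then the ordinal computations by $P$ with input $T(0)$ in $M$ and in the universe $V$ are equal. Moreover: (c) If $\mathrm{Ord}\subseteq M$ and $x,y\in M$ are sets of ordinals, then $P:\chi_x\mapsto\chi_y$ holds (in $V$) if and only if $(M,\in)\models$ "$P:\chi_x\mapsto\chi_y$". (d) If $x,y\in M$ are sets of ordinals and $(M,\in)\models$ "$P:\chi_x\mapsto\chi_y$", then $P:\chi_x\mapsto\chi_y$ holds in $V$. -/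

import Mathlib

universe u

namespace OrdinalMachine

/-! ### The language of set theory and its structures

A structure for the language of set theory is a type `A` with a membership relation `∈` between its
elements. All notions below are written with `∈` and quantifiers over `A` only, so that they can be
read in the universe `V` (the type `ZFSet`) and in any class `M` of sets with the restricted
membership relation; the latter reading is the relativization of the notion to `M`. -/

/-- The only symbol of the language of set theory is a binary relation symbol. -/
inductive MemRel : ℕ → Type
  | mem : MemRel 2

/-- The first-order language of set theory. -/
def setLanguage : FirstOrder.Language.{0, 0} :=
  ⟨fun _ => Empty, MemRel⟩

/-- A type with a membership relation is a structure for the language of set theory. -/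
instance setStructure (A : Type u) [Membership A A] : setLanguage.Structure A where
  funMap := fun f _ => f.elim
  RelMap := fun r v => match r, v with
    | .mem, v => v 0 ∈ v 1

/-- A class `M` of sets, with the membership relation of `V` restricted to it. -/
instance classMembership (M : Set ZFSet.{u}) : Membership M M where
  mem := fun y x => (x : ZFSet.{u}) ∈ (y : ZFSet.{u})

section Structures

variable {A : Type u} [Membership A A]

/-- Definability of a class of `n`-tuples by a formula with parameters from `A`. -/
def IsDefinable {n : ℕ} (D : Set (Fin n → A)) : Prop :=
  Set.Definable Set.univ setLanguage D

/-- `z` is the empty set. -/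
def IsEmptySet (z : A) : Prop := ∀ v : A, v ∉ z

/-- `y = x ∪ {x}`. -/
def IsSucc (x y : A) : Prop := ∀ v : A, v ∈ y ↔ v ∈ x ∨ v = x

/-- The axioms of `ZF` without the power set axiom: extensionality, foundation, pairing, union,
infinity, and the schemas of separation and replacement. An instance of a schema is given by a
formula with parameters, that is, by a class which is definable with parameters. -/
structure ZFMinus (A : Type u) [Membership A A] : Prop where
  extensionality : ∀ x y : A, (∀ z : A, z ∈ x ↔ z ∈ y) → x = y
  foundation : ∀ x : A, (∃ y : A, y ∈ x) → ∃ y : A, y ∈ x ∧ ∀ z : A, z ∈ x → z ∉ y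
  pairing : ∀ x y : A, ∃ p : A, ∀ z : A, z ∈ p ↔ z = x ∨ z = y
  union : ∀ x : A, ∃ w : A, ∀ z : A, z ∈ w ↔ ∃ y : A, y ∈ x ∧ z ∈ y
  infinity : ∃ w : A, (∃ z : A, z ∈ w ∧ IsEmptySet z) ∧
    ∀ x : A, x ∈ w → ∃ y : A, y ∈ w ∧ IsSucc x y
  separation : ∀ D : Set A, IsDefinable {v : Fin 1 → A | v 0 ∈ D} →
    ∀ a : A, ∃ b : A, ∀ z : A, z ∈ b ↔ z ∈ a ∧ z ∈ D
  replacement : ∀ F : A → A → Prop, IsDefinable {v : Fin 2 → A | F (v 0) (v 1)} →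
    ∀ a : A, (∀ x : A, x ∈ a → ∃! y : A, F x y) →
      ∃ b : A, ∀ y : A, y ∈ b ↔ ∃ x : A, x ∈ a ∧ F x y

/-! ### Ordinals and natural numbers of a structure -/

/-- `x` is an ordinal: a transitive set all of whose elements are transitive. -/
def IsOrd (x : A) : Prop :=
  (∀ y z : A, z ∈ y → y ∈ x → z ∈ x) ∧ ∀ w y z : A, y ∈ z → z ∈ w → w ∈ x → y ∈ w

/-- `x ≤ y`, for ordinals. -/
def OrdLE (x y : A) : Prop := x ∈ y ∨ x = y

/-- `x` is a successor ordinal. -/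
def IsSuccOrd (x : A) : Prop := IsOrd x ∧ ∃ y : A, IsSucc y x

/-- `x` is a limit ordinal (in particular `x ≠ 0`). -/
def IsLimitOrd (x : A) : Prop := IsOrd x ∧ ¬ IsEmptySet x ∧ ¬ ∃ y : A, IsSucc y x

/-- `x ∈ ω`: neither the ordinal `x` nor one of its elements is a limit ordinal. -/
def IsNat (x : A) : Prop := IsOrd x ∧ ∀ y : A, OrdLE y x → ¬ IsLimitOrd y

/-- `x` is the von Neumann numeral `n`. -/
def IsNumeral : ℕ → A → Prop
  | 0, x => IsEmptySet x
  | n + 1, x => ∃ y : A, IsNumeral n y ∧ IsSucc y x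

/-- `m` is the least element of the class `D` of ordinals. -/
def IsLeastOrd (D : A → Prop) (m : A) : Prop := D m ∧ ∀ x : A, D x → OrdLE m x

/-- `m` is the supremum of the class `D` of ordinals. -/
def IsSupOrd (D : A → Prop) (m : A) : Prop :=
  IsOrd m ∧ (∀ x : A, D x → OrdLE x m) ∧
    ∀ b : A, IsOrd b → (∀ x : A, D x → OrdLE x b) → OrdLE m b

/-- `l = liminf F(r)` for `r → t` and `C(r)`, where the function `F` is given by its graph:
the supremum, over all `s < t`, of the minimum of the `F(r)` with `s ≤ r < t` and `C(r)`. -/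
def IsLiminf (t : A) (C : A → Prop) (F : A → A → Prop) (l : A) : Prop :=
  IsSupOrd (fun m => ∃ s : A, s ∈ t ∧
    IsLeastOrd (fun x => ∃ r : A, r ∈ t ∧ OrdLE s r ∧ C r ∧ F r x) m) l

/-- `F` is the graph of a function from the class `D` to the class `E`. -/
def IsFunOn (D E : A → Prop) (F : A → A → Prop) : Prop :=
  (∀ x y : A, F x y → D x ∧ E y) ∧ ∀ x : A, D x → ∃! y : A, F x y

end Structures

/-! ### Programs -/

/-- A command `(s, c, c', m, s')`: in state `s`, reading `c`, write `c'`, move left if `m = 0` and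
right if `m = 1`, and go into state `s'`. -/
structure Command where
  source : ℕ
  read : Fin 2
  write : Fin 2
  move : Fin 2
  target : ℕ

/-- A program is a finite set of commands such that in each of its states there is a command for
both symbols, and the command is determined by the state and the symbol. -/
structure Program where
  commands : Set Command
  finite : commands.Finite
  total : ∀ C ∈ commands, ∃ D ∈ commands, D.source = C.source ∧ C.read ≠ D.read
  deterministic : ∀ C ∈ commands, ∀ D ∈ commands, C.source = D.source → C.read = D.read → C = D

/-! ### Ordinal computations in a structure -/

/-- The data `(θ, S, H, T)` of an ordinal computation. All of them are classes: `length` is the class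
of the ordinals below `θ`, `state t q` means `S(t) = q`, `head t h` means `H(t) = h`, and
`tape t ξ i` means that the `ξ`-th cell of `T(t)` contains `i`. -/
@[ext]
structure Run (A : Type u) where
  length : Set A
  state : A → A → Prop
  head : A → A → Prop
  tape : A → A → A → Prop

section Computations

variable {A : Type u} [Membership A A]

/-- `x ∈ {0, 1}`. -/
def IsBit (x : A) : Prop := IsNumeral 0 x ∨ IsNumeral 1 x

/-- The graph of a tape content, a function from `Ord` to `{0, 1}`. -/
def IsTape (X : A → A → Prop) : Prop := IsFunOn IsOrd IsBit X

/-- `q` is a program state of `P`. -/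
def IsStateOf (P : Program) (q : A) : Prop := ∃ C ∈ P.commands, IsNumeral C.source q

/-- The class of the ordinals below `b + 1`. -/
def initialClass (b : A) : Set A := {t | OrdLE t b}

/-- The head moves from `h` to `h'`, to the left if `m = 0` and to the right if `m = 1`. -/
def HeadMove (m : Fin 2) (h h' : A) : Prop :=
  (m = 1 ∧ IsSucc h h') ∨
  (m = 0 ∧ IsSuccOrd h ∧ IsSucc h' h) ∨
  (m = 0 ∧ ¬ IsSuccOrd h ∧ IsEmptySet h')

/-- The command `C` applies to the constellation of `R` at time `t`, and the constellation at time
`t'` is the result of executing it. -/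
def Executes (R : Run A) (C : Command) (t t' : A) : Prop :=
  ∃ q q' h h' : A, R.state t q ∧ R.state t' q' ∧ R.head t h ∧ R.head t' h' ∧
    IsNumeral C.source q ∧ (∃ i : A, R.tape t h i ∧ IsNumeral C.read i) ∧
    (∀ ξ i : A, R.tape t' ξ i ↔ (ξ = h ∧ IsNumeral C.write i) ∨ (ξ ≠ h ∧ R.tape t ξ i)) ∧
    IsNumeral C.target q' ∧ HeadMove C.move h h'

/-- `R` is an ordinal computation by `P`, in the sense of the structure `A`. -/
structure IsComputation (P : Program) (R : Run A) : Prop where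
  /-- `θ = Ord`, or `θ` is a successor ordinal. -/
  length_eq : R.length = {t | IsOrd t} ∨ ∃ b : A, IsOrd b ∧ R.length = initialClass b
  state_fun : IsFunOn (· ∈ R.length) IsNat R.state
  head_fun : IsFunOn (· ∈ R.length) IsOrd R.head
  tape_dom : ∀ t ξ i : A, R.tape t ξ i → t ∈ R.length
  tape_fun : ∀ t ∈ R.length, IsTape (R.tape t)
  start : ∃ z : A, IsEmptySet z ∧ R.state z z ∧ R.head z z
  /-- If `S(t)` is not a program state then `θ = t + 1`. -/
  halt : ∀ t ∈ R.length, ∀ q : A, R.state t q → ¬ IsStateOf P q → R.length = initialClass t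
  /-- If `S(t)` is a program state then `t + 1 < θ`, and the command for the state and the symbol
  under the head is executed. -/
  step : ∀ t ∈ R.length, ∀ q : A, R.state t q → IsStateOf P q →
    ∃ t' ∈ R.length, IsSucc t t' ∧ ∃ C ∈ P.commands, Executes R C t t'
  tape_limit : ∀ t ∈ R.length, IsLimitOrd t → ∀ ξ : A, IsOrd ξ →
    ∀ i : A, R.tape t ξ i → IsLiminf t (fun _ => True) (fun r => R.tape r ξ) i
  state_limit : ∀ t ∈ R.length, IsLimitOrd t →
    ∀ q : A, R.state t q → IsLiminf t (fun _ => True) R.state q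
  head_limit : ∀ t ∈ R.length, IsLimitOrd t →
    ∀ q h : A, R.state t q → R.head t h → IsLiminf t (fun s => R.state s q) R.head h

/-- `T(0) = X`. -/
def HasInput (R : Run A) (X : A → A → Prop) : Prop := ∃ z : A, IsEmptySet z ∧ R.tape z = X

/-- The computation stops: its length is `b + 1` for an ordinal `b`, and `T(b) = Y`. -/
def StopsWith (R : Run A) (Y : A → A → Prop) : Prop :=
  ∃ b : A, IsOrd b ∧ R.length = initialClass b ∧ R.tape b = Y

/-- The components of `R` are classes in the sense of the structure `A`, that is, they are definable
over it with parameters. -/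
structure Run.Definable (R : Run A) : Prop where
  length : IsDefinable {v : Fin 1 → A | v 0 ∈ R.length}
  state : IsDefinable {v : Fin 2 → A | R.state (v 0) (v 1)}
  head : IsDefinable {v : Fin 2 → A | R.head (v 0) (v 1)}
  tape : IsDefinable {v : Fin 3 → A | R.tape (v 0) (v 1) (v 2)}

/-- The graph of the characteristic function of `x` on the ordinals. -/
def charFun (x : A) : A → A → Prop := fun ξ i =>
  IsOrd ξ ∧ ((ξ ∈ x ∧ IsNumeral 1 i) ∨ (ξ ∉ x ∧ IsNumeral 0 i))

end Computations

/-! ### Computations in `V` and in a class `M` -/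

/-- `P : X ↦ Y` in the universe `V`. -/
def Computes (P : Program) (X Y : ZFSet.{u} → ZFSet.{u} → Prop) : Prop :=
  ∃ R : Run ZFSet.{u}, IsComputation P R ∧ HasInput R X ∧ StopsWith R Y

/-- `R` is the ordinal computation by `P` with input `X` as computed in `(M, ∈)`: the definition of
ordinal computations is read in `(M, ∈)`, whose classes are the classes definable over it. -/
def IsComputationIn (M : Set ZFSet.{u}) (P : Program) (X : M → M → Prop) (R : Run M) : Prop :=
  R.Definable ∧ IsComputation P R ∧ HasInput R X

/-- `(M, ∈) ⊨ "P : X ↦ Y"`. -/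
def ComputesIn (M : Set ZFSet.{u}) (P : Program) (X Y : M → M → Prop) : Prop :=
  ∃ R : Run M, IsComputationIn M P X R ∧ StopsWith R Y

/-- The restriction of a tape content to `Ord ∩ M`. -/
def restrictTape (M : Set ZFSet.{u}) (X : ZFSet.{u} → ZFSet.{u} → Prop) : M → M → Prop :=
  fun ξ i => X ξ i

/-- The restriction of a computation in `V`: its length is `θ ∩ M`, its state and head functions
are restricted to `θ ∩ M`, and its tape contents `T(t)` are restricted to `Ord ∩ M`. -/
def Run.restrict (M : Set ZFSet.{u}) (R : Run ZFSet.{u}) : Run M where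
  length := {t | (t : ZFSet.{u}) ∈ R.length}
  state := fun t q => R.state t q
  head := fun t h => R.head t h
  tape := fun t => restrictTape M (R.tape t)

/-- The classes of elements of `M` that form a computation in `M`, as classes of elements of `V`. -/
def Run.toUniverse {M : Set ZFSet.{u}} (R : Run M) : Run ZFSet.{u} where
  length := {t | ∃ t' ∈ R.length, (t' : ZFSet.{u}) = t}
  state := fun t q => ∃ t' q' : M, R.state t' q' ∧ (t' : ZFSet.{u}) = t ∧ (q' : ZFSet.{u}) = q
  head := fun t h => ∃ t' h' : M, R.head t' h' ∧ (t' : ZFSet.{u}) = t ∧ (h' : ZFSet.{u}) = h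
  tape := fun t ξ i => ∃ t' ξ' i' : M, R.tape t' ξ' i' ∧
    (t' : ZFSet.{u}) = t ∧ (ξ' : ZFSet.{u}) = ξ ∧ (i' : ZFSet.{u}) = i

/-- `M` is a transitive class. -/
def IsTransitiveClass (M : Set ZFSet.{u}) : Prop := ∀ x ∈ M, ∀ y ∈ x, y ∈ M

end OrdinalMachine

open OrdinalMachine

/-!
The conditions on an ordinal computation are local: the constellation at time `t` is determined by
the earlier ones (`ObeysAt`). By induction on the time, two computations with the same input agree
(`ObeysAt.agreeAt`, `IsComputation.unique`). This argument only needs that `∈` is well-founded and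
extensional, so that it applies both in `V` and in a transitive class `M`.

All notions that occur in the local rules are absolute between `M` and `V`, inferior limits included
(`isLiminf_coe`), since the head satisfies `H(t) ≤ t` and the states and cell contents are natural
numbers, so that all values at times in `M` belong to `M`. Hence the restriction to `M` of a
computation in `V` satisfies the definition of a computation in `M` (`IsComputation.restrict`).

What remains is that the restriction is a class of `M`, that is, definable over `M`
(`IsComputation.definable`). The tape contents are proper classes, but because of `H(t) ≤ t` only
the cells below `t` can differ from the input at time `t` (`IsComputation.tape_eq_input`).
So the constellation at time `t` is coded by the quadruple of `t`, `S(t)`, `H(t)` and the set of the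
`ξ < t` with `T(t)_ξ = 1`. As in the recursion theorem, the computation is defined in `M` by the
existence of a set of such codes which obeys the local rules up to `t` (`IsHistory`), and the
replacement axioms of `M` show by induction on `t` that such a set exists
(`IsComputation.exists_isHistory`).

Conversely, a computation in `M` that stops extends to `V`: the head never visits a cell outside
`M`, so that the tape may keep its initial contents there (`IsComputation.extend`).
-/

namespace OrdinalMachine

/-! ### Definability with parameters -/

section Definability

open FirstOrder Language

variable {A : Type u} [Membership A A] {n : ℕ}

/-- The function `f` is the interpretation of a term with parameters: a variable or a constant. -/
class DefTerm (f : (Fin n → A) → A) : Prop where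
  out : ∃ t : (setLanguage[[(Set.univ : Set A)]]).Term (Fin n), ∀ v, t.realize v = f v

/-- The class of the `v` with `p v` is definable with parameters. Stability of this notion under the
logical operations is registered by instances, so that instance search finds the formula that
defines a given class. -/
class DefPred (p : (Fin n → A) → Prop) : Prop where
  out : IsDefinable {v : Fin n → A | p v}

theorem defPred_iff {p : (Fin n → A) → Prop} :
    DefPred p ↔ ∃ φ : (setLanguage[[(Set.univ : Set A)]]).Formula (Fin n),
      ∀ v, φ.Realize v ↔ p v := by
  constructor
  · rintro ⟨φ, h⟩
    exact ⟨φ, fun v => (Set.ext_iff.1 h v).symm⟩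
  · rintro ⟨φ, h⟩
    exact ⟨φ, Set.ext fun v => (h v).symm⟩

theorem DefPred.of_iff {p q : (Fin n → A) → Prop} [hp : DefPred p] (h : ∀ v, q v ↔ p v) :
    DefPred q := by
  have : q = p := funext fun v => propext (h v)
  rwa [this]

instance DefTerm.var (i : Fin n) : DefTerm (fun v : Fin n → A => v i) := ⟨⟨.var i, fun _ => rfl⟩⟩

instance DefTerm.const (a : A) : DefTerm (fun _ : Fin n → A => a) :=
  ⟨⟨(setLanguage.con (⟨a, trivial⟩ : (Set.univ : Set A))).term, fun _ => by
    rw [Term.realize_con]⟩⟩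

instance DefPred.mem (f g : (Fin n → A) → A) [hf : DefTerm f] [hg : DefTerm g] :
    DefPred (fun v => f v ∈ g v) := by
  obtain ⟨s, hs⟩ := hf.out
  obtain ⟨t, ht⟩ := hg.out
  refine defPred_iff.2 ⟨((setLanguage.lhomWithConstants (Set.univ : Set A)).onRelation
    (MemRel.mem : setLanguage.Relations 2)).formula₂ s t, fun v => ?_⟩
  rw [Formula.realize_rel₂, ← hs, ← ht]
  exact (LHom.map_onRelation (setLanguage.lhomWithConstants (Set.univ : Set A))
    (MemRel.mem : setLanguage.Relations 2) _).to_iff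

instance DefPred.eq (f g : (Fin n → A) → A) [hf : DefTerm f] [hg : DefTerm g] :
    DefPred (fun v => f v = g v) := by
  obtain ⟨s, hs⟩ := hf.out
  obtain ⟨t, ht⟩ := hg.out
  exact defPred_iff.2 ⟨s.equal t, fun v => by rw [Formula.realize_equal, hs, ht]⟩

instance DefPred.and (p q : (Fin n → A) → Prop) [hp : DefPred p] [hq : DefPred q] :
    DefPred (fun v => p v ∧ q v) := ⟨hp.out.inter hq.out⟩

instance DefPred.or (p q : (Fin n → A) → Prop) [hp : DefPred p] [hq : DefPred q] :
    DefPred (fun v => p v ∨ q v) := ⟨hp.out.union hq.out⟩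

instance DefPred.not (p : (Fin n → A) → Prop) [hp : DefPred p] : DefPred (fun v => ¬ p v) :=
  ⟨hp.out.compl⟩

instance DefPred.imp (p q : (Fin n → A) → Prop) [hp : DefPred p] [hq : DefPred q] :
    DefPred (fun v => p v → q v) :=
  .of_iff (p := fun v => ¬ p v ∨ q v) fun _ => imp_iff_not_or

instance DefPred.iff (p q : (Fin n → A) → Prop) [hp : DefPred p] [hq : DefPred q] :
    DefPred (fun v => p v ↔ q v) :=
  .of_iff (p := fun v => (p v → q v) ∧ (q v → p v)) fun _ => iff_def

theorem DefPred.const (c : Prop) : DefPred (fun _ : Fin n → A => c) := by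
  by_cases h : c
  · exact defPred_iff.2 ⟨⊤, fun v => by simp [h]⟩
  · exact defPred_iff.2 ⟨⊥, fun v => by simp [h]⟩

instance DefPred.true : DefPred (fun _ : Fin n → A => True) := .const _

/-- A bound variable is added to the context as its last variable. -/
instance DefPred.ex (p : (Fin n → A) → A → Prop)
    [hp : DefPred fun w : Fin (n + 1) → A => p (fun i => w i.castSucc) (w (Fin.last n))] :
    DefPred (fun v => ∃ x, p v x) := by
  refine ⟨?_⟩
  have h := hp.out.image_comp (Fin.castSucc : Fin n → Fin (n + 1))
  refine (congrArg _ (Set.ext fun v => ?_)).mp h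
  constructor
  · rintro ⟨w, hw, rfl⟩
    exact ⟨_, hw⟩
  · rintro ⟨x, hx⟩
    exact ⟨Fin.snoc v x, by simpa using hx, by ext i; simp⟩

instance DefPred.all (p : (Fin n → A) → A → Prop)
    [hp : DefPred fun w : Fin (n + 1) → A => p (fun i => w i.castSucc) (w (Fin.last n))] :
    DefPred (fun v => ∀ x, p v x) :=
  .of_iff (p := fun v => ¬ ∃ x, ¬ p v x) fun v => by push Not; rfl

/-- Substitution of terms into a definable predicate. -/
theorem DefPred.subst {m : ℕ} (p : (Fin m → A) → Prop) [hp : DefPred p]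
    (f : Fin m → (Fin n → A) → A) (hf : ∀ i, DefTerm (f i)) : DefPred fun v => p fun i => f i v := by
  obtain ⟨φ, hφ⟩ := defPred_iff.1 hp
  choose t ht using fun i => (hf i).out
  refine defPred_iff.2 ⟨BoundedFormula.subst φ t, fun v => ?_⟩
  rw [Formula.Realize, BoundedFormula.realize_subst, ← Formula.Realize, hφ]
  simp only [ht]

theorem DefPred.subst₁ {p : A → Prop} (hp : DefPred fun v : Fin 1 → A => p (v 0))
    (f : (Fin n → A) → A) [hf : DefTerm f] : DefPred fun v => p (f v) :=
  DefPred.subst (fun v : Fin 1 → A => p (v 0)) ![f] (by simpa using hf)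

theorem DefPred.subst₂ {p : A → A → Prop} (hp : DefPred fun v : Fin 2 → A => p (v 0) (v 1))
    (f g : (Fin n → A) → A) [hf : DefTerm f] [hg : DefTerm g] : DefPred fun v => p (f v) (g v) :=
  DefPred.subst (fun v : Fin 2 → A => p (v 0) (v 1)) ![f, g] (by simp [Fin.forall_fin_two, hf, hg])

theorem DefPred.subst₃ {p : A → A → A → Prop}
    (hp : DefPred fun v : Fin 3 → A => p (v 0) (v 1) (v 2))
    (f g h : (Fin n → A) → A) [hf : DefTerm f] [hg : DefTerm g] [hh : DefTerm h] :
    DefPred fun v => p (f v) (g v) (h v) :=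
  DefPred.subst (fun v : Fin 3 → A => p (v 0) (v 1) (v 2)) ![f, g, h]
    (by simp [Fin.forall_fin_succ, hf, hg, hh])

/-- A finite quantifier over objects outside the structure, such as the commands of a program, is a
finite disjunction. -/
theorem DefPred.exists_mem_of_finite {ι : Type*} {s : Set ι} (hs : s.Finite)
    (p : ι → (Fin n → A) → Prop) [hp : ∀ i, DefPred (p i)] :
    DefPred fun v => ∃ i ∈ s, p i v := by
  induction s, hs using Set.Finite.induction_on with
  | empty => exact .of_iff (p := fun _ => ¬ True) (by simp)
  | insert _ _ ih =>
    have := ih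
    exact .of_iff (p := fun v => p _ v ∨ _) fun v => Set.exists_mem_insert

variable (f g : (Fin n → A) → A) [DefTerm f] [DefTerm g]

instance DefPred.isEmptySet : DefPred fun v => IsEmptySet (f v) :=
  .subst₁ (by unfold IsEmptySet; infer_instance) f

instance DefPred.isSucc : DefPred fun v => IsSucc (f v) (g v) :=
  .subst₂ (by unfold IsSucc; infer_instance) f g

instance DefPred.isOrd : DefPred fun v => IsOrd (f v) :=
  .subst₁ (by unfold IsOrd; infer_instance) f

instance DefPred.ordLE : DefPred fun v => OrdLE (f v) (g v) := by unfold OrdLE; infer_instance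

instance DefPred.isSuccOrd : DefPred fun v => IsSuccOrd (f v) :=
  .subst₁ (by unfold IsSuccOrd; infer_instance) f

instance DefPred.isLimitOrd : DefPred fun v => IsLimitOrd (f v) :=
  .subst₁ (by unfold IsLimitOrd; infer_instance) f

instance DefPred.isNumeral (k : ℕ) {n : ℕ} (f : (Fin n → A) → A) [DefTerm f] :
    DefPred fun v => IsNumeral k (f v) := by
  induction k generalizing n with
  | zero => unfold IsNumeral; infer_instance
  | succ k ih => exact .subst₁ (p := IsNumeral (k + 1)) (by unfold IsNumeral; infer_instance) f

instance DefPred.isBit : DefPred fun v => IsBit (f v) := by unfold IsBit; infer_instance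

instance DefPred.headMove (m : Fin 2) : DefPred fun v => HeadMove m (f v) (g v) := by
  unfold HeadMove
  have : ∀ {n : ℕ} (i : Fin 2), DefPred fun _ : Fin n → A => m = i := fun i => .const _
  infer_instance

theorem DefPred.charFun (x : A) :
    DefPred fun v : Fin 2 → A => OrdinalMachine.charFun x (v 0) (v 1) := by
  unfold OrdinalMachine.charFun; infer_instance

end Definability

/-! ### Ordinals in well-founded extensional structures -/

/-- The membership relation of `A` is well-founded and extensional. This holds in `V` and in every
transitive class; the well-foundedness is the external one, so that induction is not restricted to
definable classes. -/
class WFExt (A : Type u) [Membership A A] : Prop where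
  wf : WellFounded fun x y : A => x ∈ y
  ext : ∀ x y : A, (∀ z : A, z ∈ x ↔ z ∈ y) → x = y

section Ordinals

variable {A : Type u} [Membership A A] [WFExt A]

theorem WFExt.asymm {x y : A} (h : x ∈ y) : y ∉ x := (WFExt.wf (A := A)).asymmetric _ _ h

theorem WFExt.irrefl (x : A) : x ∉ x := fun h => WFExt.asymm h h

theorem IsEmptySet.unique {x y : A} (hx : IsEmptySet x) (hy : IsEmptySet y) : x = y :=
  WFExt.ext _ _ fun z => iff_of_false (hx z) (hy z)

theorem IsSucc.unique {x y y' : A} (h : IsSucc x y) (h' : IsSucc x y') : y = y' :=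
  WFExt.ext _ _ fun z => (h z).trans (h' z).symm

omit [WFExt A] in
theorem IsSucc.mem {x y : A} (h : IsSucc x y) : x ∈ y := (h x).2 (.inr rfl)

theorem IsSucc.inj {x x' y : A} (h : IsSucc x y) (h' : IsSucc x' y) : x = x' := by
  rcases (h' x).1 h.mem with hx | hx
  · rcases (h x').1 h'.mem with hx' | hx'
    · exact (WFExt.asymm hx hx').elim
    · exact hx'.symm
  · exact hx

theorem IsNumeral.unique {n : ℕ} {x y : A} (hx : IsNumeral n x) (hy : IsNumeral n y) : x = y := by
  induction n generalizing x y with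
  | zero => exact IsEmptySet.unique hx hy
  | succ n ih =>
    obtain ⟨x', hx', hx⟩ := hx
    obtain ⟨y', hy', hy⟩ := hy
    obtain rfl := ih hx' hy'
    exact hx.unique hy

theorem IsNumeral.inj {m n : ℕ} {x : A} (hm : IsNumeral m x) (hn : IsNumeral n x) : m = n := by
  induction m generalizing n x with
  | zero =>
    cases n with
    | zero => rfl
    | succ n =>
      obtain ⟨y, -, hy⟩ := hn
      exact (hm y hy.mem).elim
  | succ m ih =>
    obtain ⟨y, hy, hyx⟩ := hm
    cases n with
    | zero => exact (hn y hyx.mem).elim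
    | succ n =>
      obtain ⟨y', hy', hyx'⟩ := hn
      obtain rfl := hyx.inj hyx'
      rw [ih hy hy']

omit [WFExt A] in
theorem IsOrd.mem {x y : A} (hx : IsOrd x) (hy : y ∈ x) : IsOrd y :=
  ⟨fun z w hwz hzy => hx.2 y w z hwz hzy hy,
    fun w z z' hz hz' hw => hx.2 w z z' hz hz' (hx.1 y w hw hy)⟩

omit [WFExt A] in
theorem IsOrd.le {x y : A} (hx : IsOrd x) (hy : OrdLE y x) : IsOrd y :=
  hy.elim hx.mem fun h => h ▸ hx

omit [WFExt A] in
theorem IsEmptySet.isOrd {x : A} (h : IsEmptySet x) : IsOrd x :=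
  ⟨fun y _ _ hy => (h y hy).elim, fun w _ _ _ _ hw => (h w hw).elim⟩

omit [WFExt A] in
theorem IsSucc.isOrd {x y : A} (h : IsSucc x y) (hx : IsOrd x) : IsOrd y := by
  constructor
  · rintro w z hz hw
    rcases (h w).1 hw with hw | rfl
    · exact (h z).2 (.inl (hx.1 w z hz hw))
    · exact (h z).2 (.inl hz)
  · rintro w z z' hz hz' hw
    rcases (h w).1 hw with hw | rfl
    · exact hx.2 w z z' hz hz' hw
    · exact hx.1 z' z hz hz'

omit [WFExt A] in
theorem IsNumeral.isOrd {n : ℕ} {x : A} (h : IsNumeral n x) : IsOrd x := by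
  induction n generalizing x with
  | zero => exact IsEmptySet.isOrd h
  | succ n ih =>
    obtain ⟨y, hy, hyx⟩ := h
    exact hyx.isOrd (ih hy)

omit [WFExt A] in
theorem IsBit.isOrd {x : A} (h : IsBit x) : IsOrd x := h.elim IsNumeral.isOrd IsNumeral.isOrd

omit [WFExt A] in
theorem OrdLE.trans {x y z : A} (hz : IsOrd z) (hxy : OrdLE x y) (hyz : OrdLE y z) :
    OrdLE x z := by
  rcases hxy with hxy | rfl
  · rcases hyz with hyz | rfl
    · exact .inl (hz.1 _ _ hxy hyz)
    · exact .inl hxy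
  · exact hyz

omit [WFExt A] in
theorem OrdLE.trans_mem {x y z : A} (hz : IsOrd z) (hxy : OrdLE x y) (hyz : y ∈ z) : x ∈ z :=
  hxy.elim (fun h => hz.1 _ _ h hyz) fun h => h ▸ hyz

theorem OrdLE.antisymm {x y : A} (hxy : OrdLE x y) (hyx : OrdLE y x) : x = y := by
  rcases hxy with hxy | rfl
  · rcases hyx with hyx | rfl
    · exact (WFExt.asymm hxy hyx).elim
    · rfl
  · rfl

theorem OrdLE.not_mem {x y : A} (hxy : OrdLE x y) : y ∉ x := by
  rcases hxy with hxy | rfl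
  · exact WFExt.asymm hxy
  · exact WFExt.irrefl _

theorem IsOrd.trichotomy {x y : A} (hx : IsOrd x) (hy : IsOrd y) : x ∈ y ∨ x = y ∨ y ∈ x := by
  induction x using (WFExt.wf (A := A)).induction generalizing y with
  | _ x ihx =>
  induction y using (WFExt.wf (A := A)).induction with
  | _ y ihy =>
  by_contra! hne
  obtain ⟨hxy, hxy', hyx⟩ := hne
  refine hxy' (WFExt.ext _ _ fun z => ⟨fun hz => ?_, fun hz => ?_⟩)
  · rcases ihx z hz (hx.mem hz) hy with h | rfl | h
    · exact h
    · exact (hyx hz).elim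
    · exact (hyx (hx.1 _ _ h hz)).elim
  · rcases ihy z hz (hy.mem hz) with h | rfl | h
    · exact (hxy (hy.1 _ _ h hz)).elim
    · exact (hxy hz).elim
    · exact h

theorem IsOrd.le_of_not_mem {x y : A} (hx : IsOrd x) (hy : IsOrd y) (h : y ∉ x) : OrdLE x y := by
  rcases hx.trichotomy hy with h' | h' | h'
  · exact .inl h'
  · exact .inr h'
  · exact (h h').elim

theorem IsSucc.le_of_mem {x y z : A} (h : IsSucc x y) (hz : IsOrd z) (hx : x ∈ z) : OrdLE y z := by
  refine (h.isOrd (hz.mem hx)).le_of_not_mem hz fun hzy => ?_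
  rcases (h z).1 hzy with hzx | rfl
  · exact WFExt.asymm hx hzx
  · exact WFExt.irrefl _ hx

theorem HeadMove.unique {m : Fin 2} {h x y : A} (hx : HeadMove m h x) (hy : HeadMove m h y) :
    x = y := by
  rcases hx with ⟨hm, hx⟩ | ⟨hm, hh, hx⟩ | ⟨hm, hh, hx⟩ <;>
    rcases hy with ⟨hm', hy⟩ | ⟨hm', hh', hy⟩ | ⟨hm', hh', hy⟩
  · exact hx.unique hy
  · simp [hm] at hm'
  · simp [hm] at hm'
  · simp [hm] at hm'
  · exact hx.inj hy
  · exact (hh' hh).elim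
  · simp [hm] at hm'
  · exact (hh hh').elim
  · exact hx.unique hy

theorem IsLiminf.unique {t x y : A} {C : A → Prop} {F : A → A → Prop} (hx : IsLiminf t C F x)
    (hy : IsLiminf t C F y) : x = y :=
  (hx.2.2 y hy.1 hy.2.1).antisymm (hy.2.2 x hx.1 hx.2.1)

omit [WFExt A] in
theorem IsLiminf.congr {t x : A} {C C' : A → Prop} {F F' : A → A → Prop}
    (hC : ∀ r ∈ t, (C r ↔ C' r)) (hF : ∀ r ∈ t, ∀ y, F r y ↔ F' r y) :
    IsLiminf t C F x ↔ IsLiminf t C' F' x := by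
  have h : ∀ s y : A, (∃ r, r ∈ t ∧ OrdLE s r ∧ C r ∧ F r y) ↔
      ∃ r, r ∈ t ∧ OrdLE s r ∧ C' r ∧ F' r y := fun s y =>
    exists_congr fun r => and_congr_right fun hr => by rw [hC r hr, hF r hr]
  simp only [IsLiminf, h]

omit [WFExt A] in
/-- The inferior limit of a constant function is its value. -/
theorem IsLiminf.of_const {t c : A} (hc : IsOrd c) (ht : ¬ IsEmptySet t)
    {F : A → A → Prop} (hF : ∀ r ∈ t, ∀ x, F r x ↔ x = c) : IsLiminf t (fun _ => True) F c := by
  have hD : ∀ m : A, (∃ s ∈ t, IsLeastOrd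
      (fun x => ∃ r, r ∈ t ∧ OrdLE s r ∧ True ∧ F r x) m) → m = c := by
    rintro m ⟨s, -, ⟨r, hr, -, -, hm⟩, -⟩
    exact (hF r hr m).1 hm
  refine ⟨hc, fun m hm => .inr (hD m hm), fun b _ hb => hb c ?_⟩
  obtain ⟨s, hs⟩ : ∃ s, s ∈ t := by simpa [IsEmptySet] using ht
  refine ⟨s, hs, ⟨s, hs, .inr rfl, trivial, (hF s hs c).2 rfl⟩, ?_⟩
  rintro x ⟨r, hr, -, -, hx⟩
  exact .inr ((hF r hr x).1 hx).symm

end Ordinals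

/-! ### The local rules of a computation and uniqueness -/

section Rules

variable {A : Type u} [Membership A A]

/-- The constellations of `R` and `R'` at time `t` are equal. -/
structure AgreeAt (R R' : Run A) (t : A) : Prop where
  state : ∀ q, R.state t q ↔ R'.state t q
  head : ∀ h, R.head t h ↔ R'.head t h
  tape : ∀ ξ i, R.tape t ξ i ↔ R'.tape t ξ i

/-- The conditions on an ordinal computation by `P` with input `X` that concern the constellation
at time `t`: it is well-formed, and it is obtained from the constellations at earlier times by the
rule for `0`, for successor ordinals, or for limit ordinals. -/
structure ObeysAt (P : Program) (X : A → A → Prop) (R : Run A) (t : A) : Prop where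
  state : ∃! q, R.state t q
  head : ∃! h, R.head t h
  tape : IsTape (R.tape t)
  zero : IsEmptySet t → R.state t t ∧ R.head t t ∧ ∀ ξ i, R.tape t ξ i ↔ X ξ i
  succ : ∀ r, IsSucc r t → ∃ C ∈ P.commands, Executes R C r t
  tape_limit : IsLimitOrd t → ∀ ξ, IsOrd ξ →
    ∀ i, R.tape t ξ i → IsLiminf t (fun _ => True) (fun r => R.tape r ξ) i
  state_limit : IsLimitOrd t → ∀ q, R.state t q → IsLiminf t (fun _ => True) R.state q
  head_limit : IsLimitOrd t →
    ∀ q h, R.state t q → R.head t h → IsLiminf t (fun s => R.state s q) R.head h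

theorem Executes.congr {R R' : Run A} {C : Command} {t t' : A} (h : AgreeAt R R' t)
    (h' : AgreeAt R R' t') : Executes R C t t' ↔ Executes R' C t t' := by
  simp only [Executes, h.state, h.head, h.tape, h'.state, h'.head, h'.tape]

theorem isTape_congr {X Y : A → A → Prop} (h : ∀ ξ i, X ξ i ↔ Y ξ i) : IsTape X ↔ IsTape Y := by
  simp only [IsTape, IsFunOn, h]

theorem ObeysAt.congr {P : Program} {X : A → A → Prop} {R R' : Run A} {t : A}
    (h : ∀ r, OrdLE r t → AgreeAt R R' r) (hR : ObeysAt P X R t) : ObeysAt P X R' t := by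
  have ht := h t (.inr rfl)
  have hlt : ∀ r ∈ t, AgreeAt R R' r := fun r hr => h r (.inl hr)
  constructor
  · simpa only [ht.state] using hR.state
  · simpa only [ht.head] using hR.head
  · exact (isTape_congr ht.tape).1 hR.tape
  · simpa only [ht.state, ht.head, ht.tape] using hR.zero
  · intro r hr
    obtain ⟨C, hC, hE⟩ := hR.succ r hr
    exact ⟨C, hC, (Executes.congr (hlt r hr.mem) ht).1 hE⟩
  · intro hl ξ hξ i hi
    exact (IsLiminf.congr (fun _ _ => Iff.rfl) fun r hr => (hlt r hr).tape ξ).1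
      (hR.tape_limit hl ξ hξ i ((ht.tape ξ i).2 hi))
  · intro hl q hq
    exact (IsLiminf.congr (fun _ _ => Iff.rfl) fun r hr => (hlt r hr).state).1
      (hR.state_limit hl q ((ht.state q).2 hq))
  · intro hl q x hq hx
    exact (IsLiminf.congr (fun r hr => (hlt r hr).state q) fun r hr => (hlt r hr).head).1
      (hR.head_limit hl q x ((ht.state q).2 hq) ((ht.head x).2 hx))

/-- It suffices to compare the values of two well-formed constellations. -/
theorem AgreeAt.of_eq {P : Program} {X X' : A → A → Prop} {R R' : Run A} {t : A}
    (hR : ObeysAt P X R t) (hR' : ObeysAt P X' R' t)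
    (hs : ∀ q q', R.state t q → R'.state t q' → q = q')
    (hh : ∀ x x', R.head t x → R'.head t x' → x = x')
    (ht : ∀ ξ, IsOrd ξ → ∀ i i', R.tape t ξ i → R'.tape t ξ i' → i = i') : AgreeAt R R' t := by
  constructor
  · obtain ⟨q, hq, -⟩ := hR.state
    obtain ⟨q', hq', -⟩ := hR'.state
    exact fun x => ⟨fun h => hs _ _ h hq' ▸ hq', fun h => hs _ _ hq h ▸ hq⟩
  · obtain ⟨q, hq, -⟩ := hR.head
    obtain ⟨q', hq', -⟩ := hR'.head
    exact fun x => ⟨fun h => hh _ _ h hq' ▸ hq', fun h => hh _ _ hq h ▸ hq⟩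
  · intro ξ i
    constructor
    · intro h
      have hξ := (hR.tape.1 _ _ h).1
      obtain ⟨i', hi', -⟩ := hR'.tape.2 ξ hξ
      exact ht ξ hξ _ _ h hi' ▸ hi'
    · intro h
      have hξ := (hR'.tape.1 _ _ h).1
      obtain ⟨i', hi', -⟩ := hR.tape.2 ξ hξ
      exact ht ξ hξ _ _ hi' h ▸ hi'

variable [WFExt A]

/-- If two runs agree at time `r`, then both execute the same command, and agree at time `r + 1`. -/
theorem Executes.unique {P : Program} {X : A → A → Prop} {R R' : Run A} {C C' : Command}
    {r t : A} (hC : C ∈ P.commands) (hC' : C' ∈ P.commands) (hr : AgreeAt R R' r)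
    (hRr : ObeysAt P X R r) (hRt : ObeysAt P X R t) (hRt' : ObeysAt P X R' t)
    (hE : Executes R C r t) (hE' : Executes R' C' r t) : AgreeAt R R' t := by
  obtain ⟨q, q₁, h, h₁, hq, hq₁, hh, hh₁, hsrc, ⟨i, hi, hri⟩, hT, htg, hmv⟩ := hE
  obtain ⟨q', q₁', h', h₁', hq', hq₁', hh', hh₁', hsrc', ⟨i', hi', hri'⟩, hT', htg', hmv'⟩ := hE'
  obtain rfl := hRr.state.unique hq ((hr.state _).2 hq')
  obtain rfl := hRr.head.unique hh ((hr.head _).2 hh')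
  obtain rfl := (hRr.tape.2 h (hRr.tape.1 _ _ hi).1).unique hi ((hr.tape _ _).2 hi')
  obtain rfl := P.deterministic C hC C' hC' (hsrc.inj hsrc') (Fin.ext (hri.inj hri'))
  refine .of_eq hRt hRt' (fun x x' hx hx' => ?_) (fun x x' hx hx' => ?_) fun ξ hξ i i' hi hi' => ?_
  · rw [hRt.state.unique hx hq₁, hRt'.state.unique hx' hq₁', htg.unique htg']
  · rw [hRt.head.unique hx hh₁, hRt'.head.unique hx' hh₁', hmv.unique hmv']
  · refine (hRt.tape.2 ξ hξ).unique hi ((hT ξ i').2 ?_)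
    simpa only [hr.tape] using (hT' ξ i').1 hi'

/-- The local rules determine the constellations, by induction on the time. -/
theorem ObeysAt.agreeAt {P : Program} {X : A → A → Prop} {R R' : Run A} {t : A} (ht : IsOrd t)
    (hR : ∀ r, OrdLE r t → ObeysAt P X R r) (hR' : ∀ r, OrdLE r t → ObeysAt P X R' r) :
    AgreeAt R R' t := by
  induction t using (WFExt.wf (A := A)).induction with
  | _ t ih =>
  have ih' : ∀ r ∈ t, AgreeAt R R' r := fun r hr => ih r hr (ht.mem hr)
    (fun s hs => hR s (.inl (hs.trans_mem ht hr))) (fun s hs => hR' s (.inl (hs.trans_mem ht hr)))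
  have h := hR t (.inr rfl)
  have h' := hR' t (.inr rfl)
  by_cases h0 : IsEmptySet t
  · obtain ⟨h1, h2, h3⟩ := h.zero h0
    obtain ⟨h1', h2', h3'⟩ := h'.zero h0
    refine .of_eq h h' (fun x x' hx hx' => ?_) (fun x x' hx hx' => ?_)
      fun ξ hξ i i' hi hi' => ?_
    · rw [h.state.unique hx h1, h'.state.unique hx' h1']
    · rw [h.head.unique hx h2, h'.head.unique hx' h2']
    · exact (h.tape.2 ξ hξ).unique hi ((h3 _ _).2 ((h3' _ _).1 hi'))
  by_cases hs : ∃ r, IsSucc r t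
  · obtain ⟨r, hr⟩ := hs
    obtain ⟨C, hC, hE⟩ := h.succ r hr
    obtain ⟨C', hC', hE'⟩ := h'.succ r hr
    exact hE.unique hC hC' (ih' r hr.mem) (hR r (.inl hr.mem)) h h' hE'
  have hl : IsLimitOrd t := ⟨ht, h0, hs⟩
  have hst : ∀ q q', R.state t q → R'.state t q' → q = q' := fun q q' hq hq' =>
    ((IsLiminf.congr (fun _ _ => Iff.rfl) fun r hr => (ih' r hr).state).1
      (h.state_limit hl q hq)).unique (h'.state_limit hl q' hq')
  refine .of_eq h h' hst (fun x x' hx hx' => ?_) fun ξ hξ i i' hi hi' => ?_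
  · obtain ⟨q, hq, -⟩ := h.state
    obtain ⟨q', hq', -⟩ := h'.state
    obtain rfl := hst q q' hq hq'
    exact ((IsLiminf.congr (fun r hr => (ih' r hr).state q) fun r hr => (ih' r hr).head).1
      (h.head_limit hl q x hq hx)).unique (h'.head_limit hl q x' hq' hx')
  · exact ((IsLiminf.congr (fun _ _ => Iff.rfl) fun r hr => (ih' r hr).tape ξ).1
      (h.tape_limit hl ξ hξ i hi)).unique (h'.tape_limit hl ξ hξ i' hi')

end Rules

/-! ### Elementary properties of computations -/

namespace IsComputation

variable {A : Type u} [Membership A A] {P : Program} {X : A → A → Prop} {R : Run A}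
  (hR : IsComputation P R)

include hR

theorem isOrd {t : A} (ht : t ∈ R.length) : IsOrd t := by
  rcases hR.length_eq with h | ⟨b, hb, h⟩
  · rw [h] at ht
    exact ht
  · rw [h] at ht
    exact hb.le ht

theorem mem_of_le {r t : A} (ht : t ∈ R.length) (hr : OrdLE r t) : r ∈ R.length := by
  rcases hR.length_eq with h | ⟨b, hb, h⟩
  · rw [h] at ht ⊢
    exact IsOrd.le ht hr
  · rw [h] at ht ⊢
    exact OrdLE.trans hb hr ht

variable [WFExt A]

theorem isStateOf_of_succ_mem {r t q : A} (ht : t ∈ R.length) (hr : IsSucc r t)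
    (hq : R.state r q) : IsStateOf P q := by
  by_contra h
  have hl := hR.halt r (hR.mem_of_le ht (.inl hr.mem)) q hq h
  rw [hl] at ht
  exact OrdLE.not_mem ht hr.mem

theorem obeysAt (hX : HasInput R X) {t : A} (ht : t ∈ R.length) : ObeysAt P X R t where
  state := hR.state_fun.2 t ht
  head := hR.head_fun.2 t ht
  tape := hR.tape_fun t ht
  zero h0 := by
    obtain ⟨z, hz, h1, h2⟩ := hR.start
    obtain ⟨z', hz', h3⟩ := hX
    obtain rfl := hz.unique h0
    obtain rfl := hz'.unique h0
    exact ⟨h1, h2, fun ξ i => by rw [h3]⟩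
  succ r hr := by
    have hrl := hR.mem_of_le ht (.inl hr.mem)
    obtain ⟨q, hq, -⟩ := hR.state_fun.2 r hrl
    obtain ⟨t', -, ht', h⟩ := hR.step r hrl q hq (hR.isStateOf_of_succ_mem ht hr hq)
    rwa [ht'.unique hr] at h
  tape_limit := hR.tape_limit t ht
  state_limit := hR.state_limit t ht
  head_limit := hR.head_limit t ht

/-- A computation of length `b + 1` ends in a state outside the program. -/
theorem not_isStateOf_last {b q : A} (hl : R.length = initialClass b) (hq : R.state b q) :
    ¬ IsStateOf P q := by
  intro h
  obtain ⟨b', hb', hs, -⟩ := hR.step b (by rw [hl]; exact .inr rfl) q hq h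
  rw [hl] at hb'
  exact OrdLE.not_mem hb' hs.mem

theorem agreeAt {R' : Run A} (hR' : IsComputation P R') (hX : HasInput R X) (hX' : HasInput R' X)
    {t : A} (ht : t ∈ R.length) (ht' : t ∈ R'.length) : AgreeAt R R' t :=
  ObeysAt.agreeAt (hR.isOrd ht) (fun _ hr => hR.obeysAt hX (hR.mem_of_le ht hr))
    fun _ hr => hR'.obeysAt hX' (hR'.mem_of_le ht' hr)

/-- If one computation stops, the other one is in the same final state at that time, and stops as
well. -/
theorem length_subset {R' : Run A} (hR' : IsComputation P R') (hX : HasInput R X)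
    (hX' : HasInput R' X) : R.length ⊆ R'.length := by
  intro t ht
  have hto := hR.isOrd ht
  rcases hR'.length_eq with h | ⟨b, hb, h⟩
  · rw [h]
    exact hto
  by_contra htb
  have hbt : b ∈ t := by
    rw [h] at htb
    rcases hto.trichotomy hb with h' | h' | h'
    · exact (htb (.inl h')).elim
    · exact (htb (.inr h')).elim
    · exact h'
  have hbl := hR.mem_of_le ht (.inl hbt)
  have hbl' : b ∈ R'.length := by rw [h]; exact .inr rfl
  obtain ⟨q, hq, -⟩ := hR.state_fun.2 b hbl
  have hq' := ((hR.agreeAt hR' hX hX' hbl hbl').state q).1 hq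
  have hl := hR.halt b hbl q hq (hR'.not_isStateOf_last h hq')
  rw [hl] at ht
  exact OrdLE.not_mem ht hbt

/-- There is at most one computation by `P` with a given input. -/
theorem unique {R' : Run A} (hR' : IsComputation P R') (hX : HasInput R X)
    (hX' : HasInput R' X) : R = R' := by
  have hl := (hR.length_subset hR' hX hX').antisymm (hR'.length_subset hR hX' hX)
  have hag : ∀ t ∈ R.length, AgreeAt R R' t := fun t ht =>
    hR.agreeAt hR' hX hX' ht (hl ▸ ht)
  ext t x
  · rw [hl]
  · by_cases ht : t ∈ R.length
    · exact (hag t ht).state x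
    · exact iff_of_false (fun h => ht (hR.state_fun.1 _ _ h).1)
        fun h => ht (hl ▸ (hR'.state_fun.1 _ _ h).1)
  · by_cases ht : t ∈ R.length
    · exact (hag t ht).head x
    · exact iff_of_false (fun h => ht (hR.head_fun.1 _ _ h).1)
        fun h => ht (hl ▸ (hR'.head_fun.1 _ _ h).1)
  · by_cases ht : t ∈ R.length
    · exact (hag t ht).tape x _
    · exact iff_of_false (fun h => ht (hR.tape_dom _ _ _ h))
        fun h => ht (hl ▸ hR'.tape_dom _ _ _ h)

/-- The head is never to the right of the cell whose index is the time. At limit times, `H(t)` is the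
supremum of some of the `H(r)` with `r < t`. -/
theorem head_le {t h : A} (hh : R.head t h) : OrdLE h t := by
  induction t using (WFExt.wf (A := A)).induction generalizing h with
  | _ t ih =>
  have ht := (hR.head_fun.1 _ _ hh).1
  have hto := hR.isOrd ht
  -- Every computation has an input, namely its tape content at time `0`.
  have ob := hR.obeysAt (X := fun ξ i => ∃ z, IsEmptySet z ∧ R.tape z ξ i) (by
    obtain ⟨z, hz, -⟩ := hR.start
    exact ⟨z, hz, by ext ξ i; exact ⟨fun h => ⟨z, hz, h⟩, fun ⟨z', hz', h⟩ => hz.unique hz' ▸ h⟩⟩) ht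
  by_cases h0 : IsEmptySet t
  · exact .inr (ob.head.unique hh (ob.zero h0).2.1)
  by_cases hs : ∃ r, IsSucc r t
  · obtain ⟨r, hr⟩ := hs
    obtain ⟨C, -, q, q', h₀, h₁, -, -, hh₀, hh₁, -, -, -, -, hmv⟩ := ob.succ r hr
    obtain rfl := ob.head.unique hh hh₁
    have hle : OrdLE h₀ r := ih r hr.mem hh₀
    have hlt : h₀ ∈ t := hle.trans_mem hto hr.mem
    rcases hmv with ⟨-, hmv⟩ | ⟨-, -, hmv⟩ | ⟨-, -, hmv⟩
    · exact hmv.le_of_mem hto hlt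
    · exact .inl (hto.1 _ _ hmv.mem hlt)
    · exact hmv.isOrd.le_of_not_mem hto (hmv t)
  · obtain ⟨q, hq, -⟩ := ob.state
    refine (ob.head_limit ⟨hto, h0, hs⟩ q h hq hh).2.2 t hto ?_
    rintro m ⟨-, -, ⟨r, hr, -, -, hm⟩, -⟩
    exact .inl ((ih r hr hm).trans_mem hto hr)

/-- At time `t`, the cells with index at least `t` still have their initial contents. -/
theorem tape_eq_input (hX : HasInput R X) {t ξ : A} (ht : t ∈ R.length) (hξ : IsOrd ξ)
    (hξt : ξ ∉ t) (i : A) : R.tape t ξ i ↔ X ξ i := by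
  induction t using (WFExt.wf (A := A)).induction generalizing i with
  | _ t ih =>
  have hto := hR.isOrd ht
  have ob := hR.obeysAt hX ht
  by_cases h0 : IsEmptySet t
  · exact (ob.zero h0).2.2 ξ i
  by_cases hs : ∃ r, IsSucc r t
  · obtain ⟨r, hr⟩ := hs
    obtain ⟨C, -, q, q', h₀, h₁, -, -, hh₀, -, -, -, hT, -, -⟩ := ob.succ r hr
    have hne : ξ ≠ h₀ := by
      rintro rfl
      exact hξt ((hR.head_le hh₀).trans_mem hto hr.mem)
    rw [hT, ← ih r hr.mem (hR.mem_of_le ht (.inl hr.mem)) fun h => hξt (hto.1 _ _ h hr.mem)]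
    simp [hne]
  · have hlim : IsLimitOrd t := ⟨hto, h0, hs⟩
    have hlt : ∀ r ∈ t, ∀ j, R.tape r ξ j ↔ X ξ j := fun r hr j =>
      ih r hr (hR.mem_of_le ht (.inl hr)) (fun h => hξt (hto.1 _ _ h hr)) j
    obtain ⟨r, hr⟩ : ∃ r, r ∈ t := by simpa [IsEmptySet] using h0
    have hrt := hR.tape_fun r (hR.mem_of_le ht (.inl hr))
    obtain ⟨c, hc, hcu⟩ := hrt.2 ξ hξ
    have hco := (hrt.1 _ _ hc).2.isOrd
    have hXc : ∀ j, X ξ j ↔ j = c := fun j => by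
      rw [← hlt r hr]
      exact ⟨fun h => hcu j h, fun h => h ▸ hc⟩
    have hlc := IsLiminf.of_const (F := fun r => R.tape r ξ) hco h0
      fun s hs j => (hlt s hs j).trans (hXc j)
    obtain ⟨d, hd, hdu⟩ := ob.tape.2 ξ hξ
    obtain rfl := (ob.tape_limit hlim ξ hξ d hd).unique hlc
    exact ⟨fun h => (hXc i).2 (hdu i h), fun h => (hXc i).1 h ▸ hd⟩

end IsComputation

/-! ### Coding of tuples -/

section Tuples

variable {A : Type u} [Membership A A]

/-- `w = {x, y}`. -/
def IsUPair (w x y : A) : Prop := ∀ z, z ∈ w ↔ z = x ∨ z = y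

/-- `p` is the Kuratowski pair of `x` and `y`. -/
def IsPair (p x y : A) : Prop := ∀ w, w ∈ p ↔ IsUPair w x x ∨ IsUPair w x y

/-- `k = (x, (y, (z, w)))`. -/
def IsQuad (k x y z w : A) : Prop := ∃ u v, IsPair u z w ∧ IsPair v y u ∧ IsPair k x v

instance DefPred.isUPair {n : ℕ} (f g h : (Fin n → A) → A) [DefTerm f] [DefTerm g] [DefTerm h] :
    DefPred fun v => IsUPair (f v) (g v) (h v) :=
  .subst₃ (by unfold IsUPair; infer_instance) f g h

instance DefPred.isPair {n : ℕ} (f g h : (Fin n → A) → A) [DefTerm f] [DefTerm g] [DefTerm h] :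
    DefPred fun v => IsPair (f v) (g v) (h v) :=
  .subst₃ (by unfold IsPair; infer_instance) f g h

instance DefPred.isQuad {n : ℕ} (f g h k l : (Fin n → A) → A) [hf : DefTerm f] [hg : DefTerm g]
    [hh : DefTerm h] [hk : DefTerm k] [hl : DefTerm l] :
    DefPred fun v => IsQuad (f v) (g v) (h v) (k v) (l v) := by
  have : DefPred fun v : Fin 5 → A => IsQuad (v 0) (v 1) (v 2) (v 3) (v 4) := by
    unfold IsQuad; infer_instance
  exact .subst (fun v : Fin 5 → A => IsQuad (v 0) (v 1) (v 2) (v 3) (v 4)) ![f, g, h, k, l]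
    (by simp [Fin.forall_fin_succ, hf, hg, hh, hk, hl])

theorem ZFMinus.exists_upair (hZ : ZFMinus A) (x y : A) : ∃ w, IsUPair w x y := hZ.pairing x y

theorem IsUPair.unique [WFExt A] {w w' x y : A} (h : IsUPair w x y) (h' : IsUPair w' x y) :
    w = w' := WFExt.ext _ _ fun z => (h z).trans (h' z).symm

theorem IsPair.unique [WFExt A] {w w' x y : A} (h : IsPair w x y) (h' : IsPair w' x y) :
    w = w' := WFExt.ext _ _ fun z => (h z).trans (h' z).symm

theorem ZFMinus.exists_pair [WFExt A] (hZ : ZFMinus A) (x y : A) : ∃ w, IsPair w x y := by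
  obtain ⟨a, ha⟩ := hZ.exists_upair x x
  obtain ⟨b, hb⟩ := hZ.exists_upair x y
  obtain ⟨p, hp⟩ := hZ.exists_upair a b
  refine ⟨p, fun w => (hp w).trans (or_congr ?_ ?_)⟩
  · exact ⟨fun h => h ▸ ha, fun h => h.unique ha⟩
  · exact ⟨fun h => h ▸ hb, fun h => h.unique hb⟩

theorem IsPair.inj (hZ : ZFMinus A) {p x y x' y' : A} (h : IsPair p x y)
    (h' : IsPair p x' y') : x = x' ∧ y = y' := by
  have hx : x = x' := by
    obtain ⟨a, ha⟩ := hZ.exists_upair x x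
    rcases (h' a).1 ((h a).2 (.inl ha)) with hb | hb
    · simpa [eq_comm] using (ha x').1 ((hb x').2 (.inl rfl))
    · simpa [eq_comm] using (ha x').1 ((hb x').2 (.inl rfl))
  subst hx
  refine ⟨rfl, ?_⟩
  obtain ⟨a, ha⟩ := hZ.exists_upair x y
  obtain ⟨b, hb⟩ := hZ.exists_upair x y'
  have h1 : y = x ∨ y = y' := by
    rcases (h' a).1 ((h a).2 (.inr ha)) with hc | hc
    · exact .inl (by simpa using (hc y).1 ((ha y).2 (.inr rfl)))
    · exact (hc y).1 ((ha y).2 (.inr rfl))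
  have h2 : y' = x ∨ y' = y := by
    rcases (h b).1 ((h' b).2 (.inr hb)) with hc | hc
    · exact .inl (by simpa using (hc y').1 ((hb y').2 (.inr rfl)))
    · exact (hc y').1 ((hb y').2 (.inr rfl))
  rcases h1 with h1 | h1
  · rcases h2 with h2 | h2
    · rw [h1, h2]
    · exact h2.symm
  · exact h1

theorem ZFMinus.exists_quad [WFExt A] (hZ : ZFMinus A) (x y z w : A) : ∃ k, IsQuad k x y z w := by
  obtain ⟨u, hu⟩ := hZ.exists_pair z w
  obtain ⟨v, hv⟩ := hZ.exists_pair y u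
  obtain ⟨k, hk⟩ := hZ.exists_pair x v
  exact ⟨k, u, v, hu, hv, hk⟩

theorem IsQuad.unique [WFExt A] {k k' x y z w : A} (h : IsQuad k x y z w)
    (h' : IsQuad k' x y z w) : k = k' := by
  obtain ⟨u, v, hu, hv, hk⟩ := h
  obtain ⟨u', v', hu', hv', hk'⟩ := h'
  obtain rfl := hu.unique hu'
  obtain rfl := hv.unique hv'
  exact hk.unique hk'

theorem IsQuad.inj (hZ : ZFMinus A) {k x y z w x' y' z' w' : A} (h : IsQuad k x y z w)
    (h' : IsQuad k x' y' z' w') : x = x' ∧ y = y' ∧ z = z' ∧ w = w' := by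
  obtain ⟨u, v, hu, hv, hk⟩ := h
  obtain ⟨u', v', hu', hv', hk'⟩ := h'
  obtain ⟨rfl, rfl⟩ := hk.inj hZ hk'
  obtain ⟨rfl, rfl⟩ := hv.inj hZ hv'
  obtain ⟨rfl, rfl⟩ := hu.inj hZ hu'
  exact ⟨rfl, rfl, rfl, rfl⟩

/-- `b ∪ {k}` exists. -/
theorem ZFMinus.exists_insert (hZ : ZFMinus A) (b k : A) : ∃ c : A, ∀ z, z ∈ c ↔ z ∈ b ∨ z = k := by
  obtain ⟨s, hs⟩ := hZ.exists_upair k k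
  obtain ⟨p, hp⟩ := hZ.exists_upair b s
  obtain ⟨c, hc⟩ := hZ.union p
  refine ⟨c, fun z => (hc z).trans ⟨?_, ?_⟩⟩
  · rintro ⟨y, hy, hz⟩
    rcases (hp y).1 hy with rfl | rfl
    · exact .inl hz
    · exact .inr (by simpa using (hs z).1 hz)
  · rintro (hz | rfl)
    · exact ⟨b, (hp b).2 (.inl rfl), hz⟩
    · exact ⟨s, (hp s).2 (.inr rfl), (hs z).2 (.inl rfl)⟩

theorem ZFMinus.exists_empty (hZ : ZFMinus A) : ∃ z : A, IsEmptySet z := by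
  obtain ⟨w, ⟨z, -, hz⟩, -⟩ := hZ.infinity
  exact ⟨z, hz⟩

theorem ZFMinus.exists_numeral (hZ : ZFMinus A) (n : ℕ) : ∃ x : A, IsNumeral n x := by
  induction n with
  | zero => exact hZ.exists_empty
  | succ n ih =>
    obtain ⟨x, hx⟩ := ih
    obtain ⟨y, hy⟩ := hZ.exists_insert x x
    exact ⟨y, x, hx, hy⟩

end Tuples

/-! ### Coded histories -/

section Histories

variable {A : Type u} [Membership A A]

/-- `k` codes the constellation of `R` at time `t`: it is the quadruple of `t`, `S(t)`, `H(t)` and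
the set of the `ξ < t` with `T(t)_ξ = 1`. The other cells still have their initial contents, so that
they need not be recorded; the whole tape content is a proper class and could not be. -/
def CodesAt (R : Run A) (t k : A) : Prop :=
  ∃ q h a, IsQuad k t q h a ∧ R.state t q ∧ R.head t h ∧
    ∀ ξ, ξ ∈ a ↔ ξ ∈ t ∧ ∃ i, IsNumeral 1 i ∧ R.tape t ξ i

/-- The run with input `X` whose constellations are coded by the elements of `c`. -/
def decode (X : A → A → Prop) (c : A) : Run A where
  length := {t | ∃ k q h a, k ∈ c ∧ IsQuad k t q h a}
  state t q := ∃ k h a, k ∈ c ∧ IsQuad k t q h a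
  head t h := ∃ k q a, k ∈ c ∧ IsQuad k t q h a
  tape t ξ i := ∃ k q h a, k ∈ c ∧ IsQuad k t q h a ∧ IsOrd ξ ∧
    ((ξ ∈ t ∧ ((ξ ∈ a ∧ IsNumeral 1 i) ∨ (ξ ∉ a ∧ IsNumeral 0 i))) ∨ (ξ ∉ t ∧ X ξ i))

/-- The set `c` codes a computation by `P` with input `X` up to time `t`. Nothing is required of the
constellations at later times. -/
def IsHistory (P : Program) (X : A → A → Prop) (c t : A) : Prop :=
  ∀ r, OrdLE r t → ObeysAt P X (decode X c) r

/-- The run that consists of all the constellations that occur in coded histories. It is definable,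
as only sets are quantified over. -/
def historyRun (P : Program) (X : A → A → Prop) : Run A where
  length := {t | ∃ c, IsHistory P X c t}
  state t q := ∃ c, IsHistory P X c t ∧ (decode X c).state t q
  head t h := ∃ c, IsHistory P X c t ∧ (decode X c).head t h
  tape t ξ i := ∃ c, IsHistory P X c t ∧ (decode X c).tape t ξ i

variable {P : Program} {X : A → A → Prop} {n : ℕ} (f g h k l : (Fin n → A) → A)
  [hf : DefTerm f] [hg : DefTerm g] [hh : DefTerm h] [hk : DefTerm k] [hl : DefTerm l]

instance DefPred.decode_state : DefPred fun v => (decode X (f v)).state (g v) (h v) :=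
  .subst₃ (p := fun a b c => (decode X a).state b c) (by simp only [decode]; infer_instance) f g h

instance DefPred.decode_head : DefPred fun v => (decode X (f v)).head (g v) (h v) :=
  .subst₃ (p := fun a b c => (decode X a).head b c) (by simp only [decode]; infer_instance) f g h

variable (hX : DefPred fun v : Fin 2 → A => X (v 0) (v 1))

include hX

theorem DefPred.decode_tape : DefPred fun v => (decode X (f v)).tape (g v) (h v) (k v) := by
  have (m : ℕ) (f g : (Fin m → A) → A) [DefTerm f] [DefTerm g] : DefPred fun v => X (f v) (g v) :=
    hX.subst₂ f g
  have : DefPred fun v : Fin 4 → A => (decode X (v 0)).tape (v 1) (v 2) (v 3) := by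
    simp only [decode]; infer_instance
  exact .subst (fun v : Fin 4 → A => (decode X (v 0)).tape (v 1) (v 2) (v 3)) ![f, g, h, k]
    (by simp [Fin.forall_fin_succ, hf, hg, hh, hk])

-- The formula has more subformulas than the default bounds on instance search allow.
set_option synthInstance.maxSize 2000 in
set_option synthInstance.maxHeartbeats 200000 in
theorem DefPred.isHistory : DefPred fun v => IsHistory P X (f v) (g v) := by
  refine .subst₂ (p := fun a b => IsHistory P X a b) ?_ f g
  have (m : ℕ) (f g : (Fin m → A) → A) [DefTerm f] [DefTerm g] : DefPred fun v => X (f v) (g v) :=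
    hX.subst₂ f g
  have (m : ℕ) (f g h k : (Fin m → A) → A) [DefTerm f] [DefTerm g] [DefTerm h] [DefTerm k] :
      DefPred fun v => (decode X (f v)).tape (g v) (h v) (k v) := .decode_tape f g h k hX
  have hE : DefPred fun v : Fin 3 → A =>
      ∃ C ∈ P.commands, Executes (decode X (v 0)) C (v 1) (v 2) := by
    have (C : Command) : DefPred fun v : Fin 3 → A => Executes (decode X (v 0)) C (v 1) (v 2) := by
      unfold Executes; infer_instance
    exact .exists_mem_of_finite P.finite _
  have (m : ℕ) (f g h : (Fin m → A) → A) [DefTerm f] [DefTerm g] [DefTerm h] :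
      DefPred fun v => ∃ C ∈ P.commands, Executes (decode X (f v)) C (g v) (h v) :=
    .subst₃ (p := fun a b c => ∃ C ∈ P.commands, Executes (decode X a) C b c) hE f g h
  have hO : DefPred fun v : Fin 2 → A => ObeysAt P X (decode X (v 0)) (v 1) := by
    -- The right-hand side is the conjunction of the fields of `ObeysAt`, found by unification.
    have h (R : Run A) (t : A) : ObeysAt P X R t ↔ _ :=
      ⟨fun h => And.intro h.state (And.intro h.head (And.intro h.tape (And.intro h.zero
        (And.intro h.succ (And.intro h.tape_limit (And.intro h.state_limit h.head_limit)))))),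
        fun h => ⟨h.1, h.2.1, h.2.2.1, h.2.2.2.1, h.2.2.2.2.1, h.2.2.2.2.2.1, h.2.2.2.2.2.2.1,
          h.2.2.2.2.2.2.2⟩⟩
    simp only [h]
    simp only [IsTape, IsFunOn, IsLiminf, IsSupOrd, IsLeastOrd, ExistsUnique]
    infer_instance
  have (m : ℕ) (f g : (Fin m → A) → A) [DefTerm f] [DefTerm g] :
      DefPred fun v => ObeysAt P X (decode X (f v)) (g v) :=
    .subst₂ (p := fun a b => ObeysAt P X (decode X a) b) hO f g
  unfold IsHistory
  infer_instance

theorem DefPred.historyRun_state : DefPred fun v => (historyRun P X).state (f v) (g v) := by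
  refine .subst₂ (p := (historyRun P X).state) ?_ f g
  have (m : ℕ) (f g : (Fin m → A) → A) [DefTerm f] [DefTerm g] :
      DefPred fun v => IsHistory P X (f v) (g v) := .isHistory f g hX
  simp only [historyRun]; infer_instance

theorem DefPred.historyRun_head : DefPred fun v => (historyRun P X).head (f v) (g v) := by
  refine .subst₂ (p := (historyRun P X).head) ?_ f g
  have (m : ℕ) (f g : (Fin m → A) → A) [DefTerm f] [DefTerm g] :
      DefPred fun v => IsHistory P X (f v) (g v) := .isHistory f g hX
  simp only [historyRun]; infer_instance

theorem DefPred.historyRun_tape : DefPred fun v => (historyRun P X).tape (f v) (g v) (h v) := by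
  refine .subst₃ (p := (historyRun P X).tape) ?_ f g h
  have (m : ℕ) (f g : (Fin m → A) → A) [DefTerm f] [DefTerm g] :
      DefPred fun v => IsHistory P X (f v) (g v) := .isHistory f g hX
  have (m : ℕ) (f g h k : (Fin m → A) → A) [DefTerm f] [DefTerm g] [DefTerm h] [DefTerm k] :
      DefPred fun v => (decode X (f v)).tape (g v) (h v) (k v) := .decode_tape f g h k hX
  simp only [historyRun]; infer_instance

end Histories

/-! ### Definability of computations -/

section Definability

variable {A : Type u} [Membership A A] [WFExt A] {P : Program} {X : A → A → Prop} {R : Run A}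

theorem CodesAt.unique {t k k' : A} (hs : ∃! q, R.state t q) (hh : ∃! h, R.head t h)
    (hk : CodesAt R t k) (hk' : CodesAt R t k') : k = k' := by
  obtain ⟨q, h, a, hq, hqs, hqh, ha⟩ := hk
  obtain ⟨q', h', a', hq', hqs', hqh', ha'⟩ := hk'
  obtain rfl := hs.unique hqs hqs'
  obtain rfl := hh.unique hqh hqh'
  obtain rfl : a = a' := WFExt.ext _ _ fun z => (ha z).trans (ha' z).symm
  exact hq.unique hq'

omit [WFExt A] in
theorem CodesAt.congr {R' : Run A} {t k : A} (h : AgreeAt R R' t) :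
    CodesAt R t k ↔ CodesAt R' t k := by
  simp only [CodesAt, h.state, h.head, h.tape]

namespace IsComputation

variable (hZ : ZFMinus A) (hR : IsComputation P R) (hX : HasInput R X)

include hR hX

/-- By uniqueness, all histories that reach time `t` contain the same constellation at `t`. -/
theorem agreeAt_historyRun {t : A} (ht : t ∈ R.length) (hc : ∃ c, IsHistory P X c t) :
    AgreeAt R (historyRun P X) t := by
  have key : ∀ c, IsHistory P X c t → AgreeAt R (decode X c) t := fun c hc =>
    ObeysAt.agreeAt (hR.isOrd ht) (fun _ hr => hR.obeysAt hX (hR.mem_of_le ht hr)) hc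
  obtain ⟨c, hc⟩ := hc
  exact ⟨fun q => ⟨fun h => ⟨c, hc, ((key c hc).state q).1 h⟩,
      fun ⟨d, hd, h⟩ => ((key d hd).state q).2 h⟩,
    fun q => ⟨fun h => ⟨c, hc, ((key c hc).head q).1 h⟩,
      fun ⟨d, hd, h⟩ => ((key d hd).head q).2 h⟩,
    fun ξ i => ⟨fun h => ⟨c, hc, ((key c hc).tape ξ i).1 h⟩,
      fun ⟨d, hd, h⟩ => ((key d hd).tape ξ i).2 h⟩⟩

include hZ

/-- A set of codes for the constellations up to time `t` is a coded history. -/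
theorem isHistory_of_codesAt {t c : A} (ht : t ∈ R.length)
    (hex : ∀ r, OrdLE r t → ∃ k, CodesAt R r k)
    (hc : ∀ k, k ∈ c ↔ ∃ r, OrdLE r t ∧ CodesAt R r k) : IsHistory P X c t := by
  have key : ∀ r, OrdLE r t → AgreeAt R (decode X c) r := by
    intro r hr
    have hrl := hR.mem_of_le ht hr
    have ob := hR.obeysAt hX hrl
    obtain ⟨k, q, h, a, hk, hq, hh, ha⟩ := hex r hr
    have hkc : k ∈ c := (hc k).2 ⟨r, hr, q, h, a, hk, hq, hh, ha⟩
    have huniq : ∀ k' q' h' a', k' ∈ c → IsQuad k' r q' h' a' → q' = q ∧ h' = h ∧ a' = a := by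
      intro k' q' h' a' hk' hquad
      obtain ⟨r₁, -, q₁, h₁, a₁, hquad₁, hq₁, hh₁, ha₁⟩ := (hc k').1 hk'
      obtain ⟨rfl, rfl, rfl, rfl⟩ := hquad.inj hZ hquad₁
      exact ⟨ob.state.unique hq₁ hq, ob.head.unique hh₁ hh,
        WFExt.ext _ _ fun z => (ha₁ z).trans (ha z).symm⟩
    constructor
    · intro x
      constructor
      · intro hx
        obtain rfl := ob.state.unique hx hq
        exact ⟨k, h, a, hkc, hk⟩
      · rintro ⟨k', h', a', hk', hquad⟩
        rwa [(huniq k' x h' a' hk' hquad).1]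
    · intro x
      constructor
      · intro hx
        obtain rfl := ob.head.unique hx hh
        exact ⟨k, q, a, hkc, hk⟩
      · rintro ⟨k', q', a', hk', hquad⟩
        rwa [(huniq k' q' x a' hk' hquad).2.1]
    · intro ξ i
      -- Cells below `r` are read off from `a`, the other ones still have their initial contents.
      have hcell : IsOrd ξ → (R.tape r ξ i ↔
          (ξ ∈ r ∧ ((ξ ∈ a ∧ IsNumeral 1 i) ∨ (ξ ∉ a ∧ IsNumeral 0 i))) ∨ (ξ ∉ r ∧ X ξ i)) := by
        intro hξ
        by_cases hξr : ξ ∈ r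
        · simp only [hξr, true_and, not_true_eq_false, false_and, or_false]
          obtain ⟨j, hj, hju⟩ := ob.tape.2 ξ hξ
          have hij : R.tape r ξ i ↔ i = j := ⟨hju i, fun h => h ▸ hj⟩
          rw [hij]
          rcases (ob.tape.1 _ _ hj).2 with hb | hb
          · have hna : ξ ∉ a := fun h => by
              obtain ⟨-, i', hi', hi''⟩ := (ha ξ).1 h
              obtain rfl := hju i' hi''
              exact absurd (hi'.inj hb) (by decide)
            simp only [hna, false_and, not_false_eq_true, true_and, false_or]
            exact ⟨fun h => h ▸ hb, fun h => h.unique hb⟩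
          · have hya : ξ ∈ a := (ha ξ).2 ⟨hξr, j, hb, hj⟩
            simp only [hya, not_true_eq_false, false_and, true_and, or_false]
            exact ⟨fun h => h ▸ hb, fun h => h.unique hb⟩
        · simp only [hξr, false_and, not_false_eq_true, true_and, false_or]
          exact hR.tape_eq_input hX hrl hξ hξr i
      constructor
      · intro hx
        have hξ := (ob.tape.1 _ _ hx).1
        exact ⟨k, q, h, a, hkc, hk, hξ, (hcell hξ).1 hx⟩
      · rintro ⟨k', q', h', a', hk', hquad, hξ, hx⟩
        obtain ⟨-, -, rfl⟩ := huniq k' q' h' a' hk' hquad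
        exact (hcell hξ).2 hx
  intro r hr
  have hrl := hR.mem_of_le ht hr
  exact (hR.obeysAt hX hrl).congr fun s hs => key s (OrdLE.trans (hR.isOrd ht) hs hr)

variable (hXd : DefPred fun v : Fin 2 → A => X (v 0) (v 1))

include hXd

omit hZ in
/-- If the constellations before `t` occur in coded histories then `T(t)` is a definable class. -/
theorem defPred_tape {t : A} (ht : t ∈ R.length) (hc : ∀ r ∈ t, ∃ c, IsHistory P X c r) :
    DefPred fun v : Fin 2 → A => R.tape t (v 0) (v 1) := by
  have hto := hR.isOrd ht
  have ob := hR.obeysAt hX ht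
  have hag : ∀ r ∈ t, AgreeAt R (historyRun P X) r := fun r hr =>
    hR.agreeAt_historyRun hX (hR.mem_of_le ht (.inl hr)) (hc r hr)
  have (m : ℕ) (f g h : (Fin m → A) → A) [DefTerm f] [DefTerm g] [DefTerm h] :
      DefPred fun v => (historyRun P X).tape (f v) (g v) (h v) := .historyRun_tape f g h hXd
  by_cases h0 : IsEmptySet t
  · exact .of_iff (hp := hXd) fun v => (ob.zero h0).2.2 _ _
  by_cases hs : ∃ r, IsSucc r t
  · obtain ⟨r, hr⟩ := hs
    obtain ⟨C, -, q, q', x, x', -, -, hx, -, -, -, hT, -, -⟩ := ob.succ r hr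
    simp only [hT, (hag r hr.mem).tape]
    infer_instance
  · have hl : IsLimitOrd t := ⟨hto, h0, hs⟩
    have h : DefPred fun v : Fin 2 → A =>
        IsLiminf t (fun _ => True) (fun r => (historyRun P X).tape r (v 0)) (v 1) := by
      simp only [IsLiminf, IsSupOrd, IsLeastOrd]
      infer_instance
    refine .of_iff (p := fun v : Fin 2 → A => IsOrd (v 0) ∧
      IsLiminf t (fun _ => True) (fun r => (historyRun P X).tape r (v 0)) (v 1)) fun v => ?_
    rw [← IsLiminf.congr (F := fun r => R.tape r (v 0)) (fun _ _ => Iff.rfl)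
      fun r hr => (hag r hr).tape (v 0)]
    constructor
    · intro h
      have hξ := (ob.tape.1 _ _ h).1
      exact ⟨hξ, ob.tape_limit hl _ hξ _ h⟩
    · rintro ⟨hξ, h⟩
      obtain ⟨j, hj, -⟩ := ob.tape.2 _ hξ
      rwa [h.unique (ob.tape_limit hl _ hξ j hj)]

/-- The set of the `ξ < t` with `T(t)_ξ = 1` exists by separation. -/
theorem exists_codesAt {t : A} (ht : t ∈ R.length) (hc : ∀ r ∈ t, ∃ c, IsHistory P X c r) :
    ∃ k, CodesAt R t k := by
  have hT := hR.defPred_tape hX hXd ht hc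
  have (m : ℕ) (f g : (Fin m → A) → A) [DefTerm f] [DefTerm g] :
      DefPred fun v => R.tape t (f v) (g v) := hT.subst₂ f g
  have hD : DefPred fun v : Fin 1 → A => v 0 ∈ {ξ : A | ∃ i, IsNumeral 1 i ∧ R.tape t ξ i} := by
    simp only [Set.mem_ofPred_eq]
    infer_instance
  obtain ⟨a, ha⟩ := hZ.separation _ hD.out t
  obtain ⟨q, hq, -⟩ := hR.state_fun.2 t ht
  obtain ⟨h, hh, -⟩ := hR.head_fun.2 t ht
  obtain ⟨k, hk⟩ := hZ.exists_quad t q h a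
  exact ⟨k, q, h, a, hk, hq, hh, ha⟩

/-- Every initial part of a computation is coded by a set: the codes of the earlier constellations
form a set by replacement, as they are given by a definable function. -/
theorem exists_isHistory {t : A} (ht : t ∈ R.length) : ∃ c, IsHistory P X c t := by
  induction t using (WFExt.wf (A := A)).induction with
  | _ t ih =>
  have hto := hR.isOrd ht
  have hlt : ∀ r ∈ t, r ∈ R.length := fun r hr => hR.mem_of_le ht (.inl hr)
  have hc : ∀ r ∈ t, ∃ c, IsHistory P X c r := fun r hr => ih r hr (hlt r hr)
  have hag : ∀ r ∈ t, AgreeAt R (historyRun P X) r := fun r hr =>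
    hR.agreeAt_historyRun hX (hlt r hr) (hc r hr)
  have hex : ∀ r, OrdLE r t → ∃ k, CodesAt R r k := fun r hr =>
    hR.exists_codesAt hZ hX hXd (hR.mem_of_le ht hr) fun s hs => hc s (by
      rcases hr with hr | rfl
      · exact hto.1 _ _ hs hr
      · exact hs)
  have hF : DefPred fun v : Fin 2 → A => CodesAt (historyRun P X) (v 0) (v 1) := by
    have (m : ℕ) (f g : (Fin m → A) → A) [DefTerm f] [DefTerm g] :
      DefPred fun v => (historyRun P X).state (f v) (g v) := .historyRun_state f g hXd
    have (m : ℕ) (f g : (Fin m → A) → A) [DefTerm f] [DefTerm g] :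
      DefPred fun v => (historyRun P X).head (f v) (g v) := .historyRun_head f g hXd
    have (m : ℕ) (f g h : (Fin m → A) → A) [DefTerm f] [DefTerm g] [DefTerm h] :
      DefPred fun v => (historyRun P X).tape (f v) (g v) (h v) := .historyRun_tape f g h hXd
    unfold CodesAt
    infer_instance
  obtain ⟨b, hb⟩ := hZ.replacement _ hF.out t fun r hr => by
    obtain ⟨k, hk⟩ := hex r (.inl hr)
    refine ⟨k, (CodesAt.congr (hag r hr)).1 hk, fun k' hk' => ?_⟩
    exact CodesAt.unique (hR.state_fun.2 r (hlt r hr)) (hR.head_fun.2 r (hlt r hr))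
      ((CodesAt.congr (hag r hr)).2 hk') hk
  obtain ⟨k, hk⟩ := hex t (.inr rfl)
  obtain ⟨c, hcm⟩ := hZ.exists_insert b k
  refine ⟨c, hR.isHistory_of_codesAt hZ hX ht hex fun k' => (hcm k').trans ?_⟩
  rw [hb]
  constructor
  · rintro (⟨r, hr, hk'⟩ | rfl)
    · exact ⟨r, .inl hr, (CodesAt.congr (hag r hr)).2 hk'⟩
    · exact ⟨t, .inr rfl, hk⟩
  · rintro ⟨r, hr | rfl, hk'⟩
    · exact .inl ⟨r, hr, (CodesAt.congr (hag r hr)).1 hk'⟩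
    · exact .inr (CodesAt.unique (hR.state_fun.2 _ ht) (hR.head_fun.2 _ ht) hk' hk)

/-- In a well-founded model of `ZF⁻`, the components of a computation with definable input are
definable classes. -/
theorem definable : R.Definable := by
  have hlen : DefPred fun v : Fin 1 → A => v 0 ∈ R.length := by
    rcases hR.length_eq with h | ⟨b, -, h⟩
    · simp only [h, Set.mem_ofPred_eq]; infer_instance
    · simp only [h, initialClass, Set.mem_ofPred_eq]; infer_instance
  have (m : ℕ) (f : (Fin m → A) → A) [DefTerm f] : DefPred fun v => f v ∈ R.length :=
    hlen.subst₁ f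
  have hag : ∀ t ∈ R.length, AgreeAt R (historyRun P X) t := fun t ht =>
    hR.agreeAt_historyRun hX ht (hR.exists_isHistory hZ hX hXd ht)
  have hs : DefPred fun v : Fin 2 → A => (historyRun P X).state (v 0) (v 1) :=
    .historyRun_state _ _ hXd
  have hh : DefPred fun v : Fin 2 → A => (historyRun P X).head (v 0) (v 1) :=
    .historyRun_head _ _ hXd
  have ht : DefPred fun v : Fin 3 → A => (historyRun P X).tape (v 0) (v 1) (v 2) :=
    .historyRun_tape _ _ _ hXd
  refine ⟨hlen.out, ?_, ?_, ?_⟩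
  · refine (DefPred.of_iff (p := fun v : Fin 2 → A => v 0 ∈ R.length ∧
      (historyRun P X).state (v 0) (v 1)) fun v => ?_).out
    exact ⟨fun h => ⟨(hR.state_fun.1 _ _ h).1, ((hag _ (hR.state_fun.1 _ _ h).1).state _).1 h⟩,
      fun ⟨h, h'⟩ => ((hag _ h).state _).2 h'⟩
  · refine (DefPred.of_iff (p := fun v : Fin 2 → A => v 0 ∈ R.length ∧
      (historyRun P X).head (v 0) (v 1)) fun v => ?_).out
    exact ⟨fun h => ⟨(hR.head_fun.1 _ _ h).1, ((hag _ (hR.head_fun.1 _ _ h).1).head _).1 h⟩,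
      fun ⟨h, h'⟩ => ((hag _ h).head _).2 h'⟩
  · refine (DefPred.of_iff (p := fun v : Fin 3 → A => v 0 ∈ R.length ∧
      (historyRun P X).tape (v 0) (v 1) (v 2)) fun v => ?_).out
    exact ⟨fun h => ⟨hR.tape_dom _ _ _ h, ((hag _ (hR.tape_dom _ _ _ h)).tape _ _).1 h⟩,
      fun ⟨h, h'⟩ => ((hag _ h).tape _ _).2 h'⟩

end IsComputation

end Definability

/-! ### Absoluteness for transitive classes -/

instance : WFExt ZFSet.{u} where
  wf := ZFSet.mem_wf
  ext _ _ h := ZFSet.ext h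

section Absoluteness

variable {M : Set ZFSet.{u}} (hM : IsTransitiveClass M)

include hM

theorem IsTransitiveClass.wfExt : WFExt M where
  wf := InvImage.wf (Subtype.val : M → ZFSet.{u}) ZFSet.mem_wf
  ext x y h := Subtype.ext <| ZFSet.ext fun z =>
    ⟨fun hz => (h ⟨z, hM x x.2 z hz⟩).1 hz, fun hz => (h ⟨z, hM y y.2 z hz⟩).2 hz⟩

theorem isEmptySet_coe {x : M} : IsEmptySet (x : ZFSet.{u}) ↔ IsEmptySet x :=
  ⟨fun h v => h v, fun h v hv => h ⟨v, hM x x.2 v hv⟩ hv⟩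

omit hM in
theorem ordLE_coe {x y : M} : OrdLE (x : ZFSet.{u}) y ↔ OrdLE x y :=
  or_congr Iff.rfl Subtype.ext_iff.symm

theorem isSucc_coe {x y : M} : IsSucc (x : ZFSet.{u}) y ↔ IsSucc x y := by
  constructor
  · exact fun h v => (h v).trans (or_congr Iff.rfl Subtype.ext_iff.symm)
  · intro h v
    constructor
    · intro hv
      exact ((h ⟨v, hM y y.2 v hv⟩).1 hv).imp id fun h => congrArg Subtype.val h
    · rintro (hv | rfl)
      · exact (h ⟨v, hM x x.2 v hv⟩).2 (.inl hv)
      · exact h.mem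

theorem isOrd_coe {x : M} : IsOrd (x : ZFSet.{u}) ↔ IsOrd x := by
  constructor
  · exact fun h => ⟨fun y z => h.1 y z, fun w y z => h.2 w y z⟩
  · intro h
    refine ⟨fun y z hz hy => ?_, fun w y z hy hz hw => ?_⟩
    · have hyM := hM x x.2 y hy
      exact h.1 ⟨y, hyM⟩ ⟨z, hM y hyM z hz⟩ hz hy
    · have hwM := hM x x.2 w hw
      have hzM := hM w hwM z hz
      exact h.2 ⟨w, hwM⟩ ⟨y, hM z hzM y hy⟩ ⟨z, hzM⟩ hy hz hw

theorem exists_isSucc_coe {x : M} :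
    (∃ y : ZFSet.{u}, IsSucc y x) ↔ ∃ y : M, IsSucc y x := by
  constructor
  · rintro ⟨y, hy⟩
    exact ⟨⟨y, hM x x.2 y hy.mem⟩, (isSucc_coe hM).1 hy⟩
  · rintro ⟨y, hy⟩
    exact ⟨y, (isSucc_coe hM).2 hy⟩

theorem isSuccOrd_coe {x : M} : IsSuccOrd (x : ZFSet.{u}) ↔ IsSuccOrd x :=
  and_congr (isOrd_coe hM) (exists_isSucc_coe hM)

theorem isLimitOrd_coe {x : M} : IsLimitOrd (x : ZFSet.{u}) ↔ IsLimitOrd x :=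
  and_congr (isOrd_coe hM) (and_congr (not_congr (isEmptySet_coe hM))
    (not_congr (exists_isSucc_coe hM)))

omit hM in
theorem IsTransitiveClass.mem_of_ordLE (hM : IsTransitiveClass M) {x : ZFSet.{u}} {y : M}
    (h : OrdLE x y) : x ∈ M := h.elim (hM y y.2 x) fun h => h ▸ y.2

theorem isNat_coe {x : M} : IsNat (x : ZFSet.{u}) ↔ IsNat x := by
  refine and_congr (isOrd_coe hM) ⟨fun h y hy hl => ?_, fun h y hy hl => ?_⟩
  · exact h y (ordLE_coe.2 hy) ((isLimitOrd_coe hM).2 hl)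
  · lift y to M using hM.mem_of_ordLE hy
    exact h y (ordLE_coe.1 hy) ((isLimitOrd_coe hM).1 hl)

theorem isNumeral_coe {n : ℕ} {x : M} : IsNumeral n (x : ZFSet.{u}) ↔ IsNumeral n x := by
  induction n generalizing x with
  | zero => exact isEmptySet_coe hM
  | succ n ih =>
    constructor
    · rintro ⟨y, hy, hyx⟩
      lift y to M using hM x x.2 y hyx.mem
      exact ⟨y, ih.1 hy, (isSucc_coe hM).1 hyx⟩
    · rintro ⟨y, hy, hyx⟩
      exact ⟨y, ih.2 hy, (isSucc_coe hM).2 hyx⟩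

theorem isBit_coe {x : M} : IsBit (x : ZFSet.{u}) ↔ IsBit x :=
  or_congr (isNumeral_coe hM) (isNumeral_coe hM)

theorem headMove_coe {m : Fin 2} {h h' : M} :
    HeadMove m (h : ZFSet.{u}) h' ↔ HeadMove m h h' := by
  simp only [HeadMove, isSucc_coe hM, isSuccOrd_coe hM, isEmptySet_coe hM]

theorem isStateOf_coe {P : Program} {q : M} : IsStateOf P (q : ZFSet.{u}) ↔ IsStateOf P q := by
  simp only [IsStateOf, isNumeral_coe hM]

theorem charFun_coe {x ξ i : M} : charFun (x : ZFSet.{u}) ξ i ↔ charFun x ξ i := by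
  simp only [charFun, isNumeral_coe hM, isOrd_coe hM]
  rfl

/-- An ordinal of `M` is the supremum in `M` of a class of ordinals of `M` if and only if it is the
supremum in `V`: an ordinal which is not in `M` exceeds all ordinals of `M`. -/
theorem isSupOrd_coe {D : ZFSet.{u} → Prop} {D' : M → Prop} (hD : ∀ x : M, D x ↔ D' x)
    (hDM : ∀ x, D x → x ∈ M) {l : M} : IsSupOrd D (l : ZFSet.{u}) ↔ IsSupOrd D' l := by
  constructor
  · rintro ⟨hl, hub, hle⟩
    refine ⟨(isOrd_coe hM).1 hl, fun x hx => ordLE_coe.1 (hub x ((hD x).2 hx)), fun b hb h => ?_⟩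
    refine ordLE_coe.1 (hle b ((isOrd_coe hM).2 hb) fun x hx => ?_)
    lift x to M using hDM x hx
    exact ordLE_coe.2 (h x ((hD x).1 hx))
  · rintro ⟨hl, hub, hle⟩
    refine ⟨(isOrd_coe hM).2 hl, fun x hx => ?_, fun b hb h => ?_⟩
    · lift x to M using hDM x hx
      exact ordLE_coe.2 (hub x ((hD x).1 hx))
    · by_cases hbM : b ∈ M
      · lift b to M using hbM
        exact ordLE_coe.2 (hle b ((isOrd_coe hM).1 hb) fun x hx =>
          ordLE_coe.1 (h x ((hD x).2 hx)))
      · exact ((isOrd_coe hM).2 hl).le_of_not_mem hb fun h => hbM (hM l l.2 b h)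

/-- Inferior limits are absolute, provided that the values of the function belong to `M`. -/
theorem isLiminf_coe {t l : M} {C : ZFSet.{u} → Prop} {F : ZFSet.{u} → ZFSet.{u} → Prop}
    {C' : M → Prop} {F' : M → M → Prop} (hC : ∀ r ∈ t, C (r : ZFSet.{u}) ↔ C' r)
    (hF : ∀ r ∈ t, ∀ x : M, F r x ↔ F' r x) (hFM : ∀ r ∈ t, ∀ x, F (r : ZFSet.{u}) x → x ∈ M) :
    IsLiminf (t : ZFSet.{u}) C F l ↔ IsLiminf t C' F' l := by
  have h (s x : M) :
      (∃ r : ZFSet.{u}, r ∈ (t : ZFSet.{u}) ∧ OrdLE (s : ZFSet.{u}) r ∧ C r ∧ F r x) ↔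
      ∃ r : M, r ∈ t ∧ OrdLE s r ∧ C' r ∧ F' r x := by
    constructor
    · rintro ⟨r, hr, hs, hc, hf⟩
      lift r to M using hM t t.2 r hr
      exact ⟨r, hr, ordLE_coe.1 hs, (hC r hr).1 hc, (hF r hr x).1 hf⟩
    · rintro ⟨r, hr, hs, hc, hf⟩
      exact ⟨r, hr, ordLE_coe.2 hs, (hC r hr).2 hc, (hF r hr x).2 hf⟩
  have hm (s x : ZFSet.{u})
      (hx : ∃ r : ZFSet.{u}, r ∈ (t : ZFSet.{u}) ∧ OrdLE s r ∧ C r ∧ F r x) : x ∈ M := by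
    obtain ⟨r, hr, -, -, hf⟩ := hx
    exact hFM ⟨r, hM t t.2 r hr⟩ hr x hf
  refine isSupOrd_coe hM (fun x => ?_) fun x ⟨s, hs, hx, _⟩ => hm s x hx
  constructor
  · rintro ⟨s, hs, hx, hle⟩
    lift s to M using hM t t.2 s hs
    exact ⟨s, hs, (h s x).1 hx, fun y hy => ordLE_coe.1 (hle y ((h s y).2 hy))⟩
  · rintro ⟨s, hs, hx, hle⟩
    refine ⟨s, hs, (h s x).2 hx, fun y hy => ?_⟩
    lift y to M using hm _ _ hy
    exact ordLE_coe.2 (hle y ((h s y).1 hy))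

variable (hZ : ZFMinus M)

include hZ

theorem mem_of_isEmptySet {x : ZFSet.{u}} (h : IsEmptySet x) : x ∈ M := by
  obtain ⟨z, hz⟩ := hZ.exists_empty
  exact h.unique ((isEmptySet_coe hM).2 hz) ▸ z.2

theorem mem_of_isSucc {x y : ZFSet.{u}} (h : IsSucc x y) (hx : x ∈ M) : y ∈ M := by
  lift x to M using hx
  obtain ⟨z, hz⟩ := hZ.exists_insert x x
  exact h.unique ((isSucc_coe hM).2 hz) ▸ z.2

theorem mem_of_isNumeral {n : ℕ} {x : ZFSet.{u}} (h : IsNumeral n x) : x ∈ M := by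
  obtain ⟨z, hz⟩ := hZ.exists_numeral n
  exact h.unique ((isNumeral_coe hM).2 hz) ▸ z.2

theorem mem_of_isBit {x : ZFSet.{u}} (h : IsBit x) : x ∈ M :=
  h.elim (mem_of_isNumeral hM hZ) (mem_of_isNumeral hM hZ)

/-- All natural numbers of `V` are elements of `M`. -/
theorem mem_of_isNat {x : ZFSet.{u}} (h : IsNat x) : x ∈ M := by
  induction x using ZFSet.mem_wf.induction with
  | _ x ih =>
  by_cases h0 : IsEmptySet x
  · exact mem_of_isEmptySet hM hZ h0
  by_cases hs : ∃ y, IsSucc y x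
  · obtain ⟨y, hy⟩ := hs
    exact mem_of_isSucc hM hZ hy (ih y hy.mem ⟨h.1.mem hy.mem, fun z hz =>
      h.2 z (hz.trans h.1 (.inl hy.mem))⟩)
  · exact (h.2 x (.inr rfl) ⟨h.1, h0, hs⟩).elim

theorem isTape_restrictTape {X : ZFSet.{u} → ZFSet.{u} → Prop} (hX : IsTape X) :
    IsTape (restrictTape M X) := by
  refine ⟨fun ξ i h => ⟨(isOrd_coe hM).1 (hX.1 _ _ h).1, (isBit_coe hM).1 (hX.1 _ _ h).2⟩,
    fun ξ hξ => ?_⟩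
  obtain ⟨i, hi, hu⟩ := hX.2 ξ ((isOrd_coe hM).2 hξ)
  lift i to M using mem_of_isBit hM hZ (hX.1 _ _ hi).2
  exact ⟨i, hi, fun j hj => Subtype.ext (hu j hj)⟩

theorem isTape_charFun (x : ZFSet.{u}) : IsTape (charFun x) := by
  refine ⟨fun ξ i h => ⟨h.1, h.2.elim (fun h => .inr h.2) fun h => .inl h.2⟩, fun ξ hξ => ?_⟩
  by_cases hx : ξ ∈ x
  · obtain ⟨i, hi⟩ := hZ.exists_numeral 1
    have hi' := (isNumeral_coe hM).2 hi
    refine ⟨i, ⟨hξ, .inl ⟨hx, hi'⟩⟩, fun j hj => ?_⟩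
    rcases hj.2 with h | h
    · exact h.2.unique hi'
    · exact (h.1 hx).elim
  · obtain ⟨i, hi⟩ := hZ.exists_numeral 0
    have hi' := (isNumeral_coe hM).2 hi
    refine ⟨i, ⟨hξ, .inr ⟨hx, hi'⟩⟩, fun j hj => ?_⟩
    rcases hj.2 with h | h
    · exact (hx h.1).elim
    · exact h.2.unique hi'

end Absoluteness

/-! ### Restriction of a computation in `V` to `M` -/

namespace IsComputation

variable {M : Set ZFSet.{u}} (hM : IsTransitiveClass M) (hZ : ZFMinus M) {P : Program}
  {R : Run ZFSet.{u}} (hR : IsComputation P R)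

include hM hZ

theorem hasInput_restrict {X : ZFSet.{u} → ZFSet.{u} → Prop} (hX : HasInput R X) :
    HasInput (R.restrict M) (restrictTape M X) := by
  obtain ⟨z, hz, hzX⟩ := hX
  lift z to M using mem_of_isEmptySet hM hZ hz
  exact ⟨z, (isEmptySet_coe hM).1 hz, by rw [← hzX]; rfl⟩

include hR

theorem restrict : IsComputation P (R.restrict M) where
  length_eq := by
    rcases hR.length_eq with h | ⟨b, hb, h⟩
    · left
      ext t
      simp only [Run.restrict, h, Set.mem_ofPred_eq, isOrd_coe hM]
    by_cases hbM : b ∈ M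
    · lift b to M using hbM
      refine .inr ⟨b, (isOrd_coe hM).1 hb, ?_⟩
      ext t
      simp only [Run.restrict, h, initialClass, Set.mem_ofPred_eq, ordLE_coe]
    · -- A computation that stops, but not at a time in `M`, has length `Ord` in `M`.
      left
      ext t
      simp only [Run.restrict, h, initialClass, Set.mem_ofPred_eq]
      refine ⟨fun ht => (isOrd_coe hM).1 (hb.le ht), fun ht => ?_⟩
      exact ((isOrd_coe hM).2 ht).le_of_not_mem hb fun h => hbM (hM t t.2 b h)
  state_fun := by
    refine ⟨fun t q h => ⟨(hR.state_fun.1 _ _ h).1, (isNat_coe hM).1 (hR.state_fun.1 _ _ h).2⟩,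
      fun t ht => ?_⟩
    obtain ⟨q, hq, hu⟩ := hR.state_fun.2 t ht
    lift q to M using mem_of_isNat hM hZ (hR.state_fun.1 _ _ hq).2
    exact ⟨q, hq, fun q' hq' => Subtype.ext (hu q' hq')⟩
  head_fun := by
    refine ⟨fun t q h => ⟨(hR.head_fun.1 _ _ h).1, (isOrd_coe hM).1 (hR.head_fun.1 _ _ h).2⟩,
      fun t ht => ?_⟩
    obtain ⟨q, hq, hu⟩ := hR.head_fun.2 t ht
    lift q to M using hM.mem_of_ordLE (hR.head_le hq)
    exact ⟨q, hq, fun q' hq' => Subtype.ext (hu q' hq')⟩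
  tape_dom t ξ i h := hR.tape_dom _ _ _ h
  tape_fun t ht := isTape_restrictTape hM hZ (hR.tape_fun t ht)
  start := by
    obtain ⟨z, hz, h⟩ := hR.start
    lift z to M using mem_of_isEmptySet hM hZ hz
    exact ⟨z, (isEmptySet_coe hM).1 hz, h⟩
  halt t ht q hq hP := by
    have h := hR.halt t ht q hq (mt (isStateOf_coe hM).1 hP)
    ext t
    simp only [Run.restrict, h, initialClass, Set.mem_ofPred_eq, ordLE_coe]
  step t ht q hq hP := by
    obtain ⟨t', ht', hs, C, hC, x, x', h, h', hx, hx', hh, hh', hsrc, ⟨i, hi, hi'⟩, hT, htg, hmv⟩ :=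
      hR.step t ht q hq ((isStateOf_coe hM).2 hP)
    lift t' to M using mem_of_isSucc hM hZ hs t.2
    lift x to M using mem_of_isNat hM hZ (hR.state_fun.1 _ _ hx).2
    lift x' to M using mem_of_isNat hM hZ (hR.state_fun.1 _ _ hx').2
    lift h to M using hM.mem_of_ordLE (hR.head_le hh)
    lift h' to M using hM.mem_of_ordLE (hR.head_le hh')
    lift i to M using mem_of_isNumeral hM hZ hi'
    refine ⟨t', ht', (isSucc_coe hM).1 hs, C, hC, x, x', h, h', hx, hx', hh, hh',
      (isNumeral_coe hM).1 hsrc, ⟨i, hi, (isNumeral_coe hM).1 hi'⟩, fun ξ j => ?_,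
      (isNumeral_coe hM).1 htg, (headMove_coe hM).1 hmv⟩
    refine (hT ξ j).trans ?_
    simp only [isNumeral_coe hM, Subtype.ext_iff, ne_eq]
    rfl
  tape_limit t ht hl ξ hξ i hi := by
    refine (isLiminf_coe hM (fun _ _ => Iff.rfl) (fun _ _ _ => Iff.rfl) fun r _ x hx => ?_).1
      (hR.tape_limit t ht ((isLimitOrd_coe hM).2 hl) ξ ((isOrd_coe hM).2 hξ) i hi)
    exact mem_of_isBit hM hZ ((hR.tape_fun r (hR.tape_dom _ _ _ hx)).1 _ _ hx).2
  state_limit t ht hl q hq := by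
    refine (isLiminf_coe hM (fun _ _ => Iff.rfl) (fun _ _ _ => Iff.rfl) fun r _ x hx => ?_).1
      (hR.state_limit t ht ((isLimitOrd_coe hM).2 hl) q hq)
    exact mem_of_isNat hM hZ (hR.state_fun.1 _ _ hx).2
  head_limit t ht hl q h hq hh := by
    refine (isLiminf_coe hM (fun _ _ => Iff.rfl) (fun _ _ _ => Iff.rfl) fun r _ x hx => ?_).1
      (hR.head_limit t ht ((isLimitOrd_coe hM).2 hl) q h hq hh)
    exact hM.mem_of_ordLE (hR.head_le hx)

/-- The restriction of a computation in `V` is a computation in `M`. -/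
theorem isComputationIn_restrict {X : ZFSet.{u} → ZFSet.{u} → Prop} (hX : HasInput R X)
    (hXd : IsDefinable {v : Fin 2 → M | restrictTape M X (v 0) (v 1)}) :
    IsComputationIn M P (restrictTape M X) (R.restrict M) :=
  have := hM.wfExt
  have hR' := hR.restrict hM hZ
  have hX' := hasInput_restrict hM hZ hX
  ⟨hR'.definable hZ hX' ⟨hXd⟩, hR', hX'⟩

end IsComputation

theorem IsOrd.isOrdinal {a : ZFSet.{u}} (h : IsOrd a) : a.IsOrdinal :=
  ⟨fun y hy z hz => h.1 y z hz hy, fun hy hz hw => h.2 _ _ _ hy hz hw⟩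

/-- If `M` contains all ordinals then nothing is lost by the restriction to `M`. -/
theorem IsComputation.toUniverse_restrict {M : Set ZFSet.{u}}
    (hOrd : ∀ a : ZFSet.{u}, a.IsOrdinal → a ∈ M) {P : Program}
    {R : Run ZFSet.{u}} (hR : IsComputation P R) : (R.restrict M).toUniverse = R := by
  have hO : ∀ a : ZFSet.{u}, IsOrd a → a ∈ M := fun a ha => hOrd a ha.isOrdinal
  ext t x i
  · constructor
    · rintro ⟨t, ht, rfl⟩
      exact ht
    · exact fun ht => ⟨⟨t, hO t (hR.isOrd ht)⟩, ht, rfl⟩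
  · constructor
    · rintro ⟨t, q, h, rfl, rfl⟩
      exact h
    · intro h
      have h' := hR.state_fun.1 _ _ h
      exact ⟨⟨t, hO t (hR.isOrd h'.1)⟩, ⟨x, hO x h'.2.1⟩, h, rfl, rfl⟩
  · constructor
    · rintro ⟨t, q, h, rfl, rfl⟩
      exact h
    · intro h
      have h' := hR.head_fun.1 _ _ h
      exact ⟨⟨t, hO t (hR.isOrd h'.1)⟩, ⟨x, hO x h'.2⟩, h, rfl, rfl⟩
  · constructor
    · rintro ⟨t, ξ, i, h, rfl, rfl, rfl⟩
      exact h
    · intro h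
      have ht := hR.tape_dom _ _ _ h
      have h' := (hR.tape_fun t ht).1 _ _ h
      exact ⟨⟨t, hO t (hR.isOrd ht)⟩, ⟨x, hO x h'.1⟩, ⟨i, hO i h'.2.isOrd⟩, h, rfl, rfl, rfl⟩

/-! ### Extension of a stopping computation in `M` to `V` -/

section Extension

variable {M : Set ZFSet.{u}}

/-- The classes of a run in `M`, where the tape contents are extended to `Ord` by the values of `X`
on the ordinals that are not in `M`. -/
def Run.extend (R : Run M) (X : ZFSet.{u} → ZFSet.{u} → Prop) : Run ZFSet.{u} where
  length := R.toUniverse.length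
  state := R.toUniverse.state
  head := R.toUniverse.head
  tape t ξ i := R.toUniverse.tape t ξ i ∨ (t ∈ R.toUniverse.length ∧ ξ ∉ M ∧ X ξ i)

variable {R : Run M} {X : ZFSet.{u} → ZFSet.{u} → Prop}

theorem Run.extend_length_coe {t : M} : (t : ZFSet.{u}) ∈ (R.extend X).length ↔ t ∈ R.length :=
  ⟨fun ⟨_, h, e⟩ => Subtype.ext e ▸ h, fun h => ⟨t, h, rfl⟩⟩

theorem Run.extend_state_coe {t q : M} : (R.extend X).state t q ↔ R.state t q :=
  ⟨fun ⟨_, _, h, e, e'⟩ => Subtype.ext e ▸ Subtype.ext e' ▸ h, fun h => ⟨t, q, h, rfl, rfl⟩⟩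

theorem Run.extend_head_coe {t h : M} : (R.extend X).head t h ↔ R.head t h :=
  ⟨fun ⟨_, _, h, e, e'⟩ => Subtype.ext e ▸ Subtype.ext e' ▸ h, fun h => ⟨t, _, h, rfl, rfl⟩⟩

theorem Run.extend_tape_coe {t ξ i : M} : (R.extend X).tape t ξ i ↔ R.tape t ξ i := by
  constructor
  · rintro (⟨t', ξ', i', h, e, e', e''⟩ | ⟨-, h, -⟩)
    · obtain rfl := Subtype.ext e
      obtain rfl := Subtype.ext e'
      obtain rfl := Subtype.ext e''
      exact h
    · exact (h ξ.2).elim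
  · exact fun h => .inl ⟨t, ξ, i, h, rfl, rfl, rfl⟩

theorem Run.extend_tape_of_not_mem {t ξ i : ZFSet.{u}} (hξ : ξ ∉ M) :
    (R.extend X).tape t ξ i ↔ t ∈ (R.extend X).length ∧ X ξ i := by
  constructor
  · rintro (⟨t', ξ', i', -, -, rfl, -⟩ | ⟨ht, -, h⟩)
    · exact (hξ ξ'.2).elim
    · exact ⟨ht, h⟩
  · exact fun h => .inr ⟨h.1, hξ, h.2⟩

theorem Run.mem_of_mem_extend_length {t : ZFSet.{u}} (h : t ∈ (R.extend X).length) : t ∈ M := by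
  obtain ⟨t', -, rfl⟩ := h
  exact t'.2

theorem Run.mem_of_extend_state {t q : ZFSet.{u}} (h : (R.extend X).state t q) :
    t ∈ M ∧ q ∈ M := by
  obtain ⟨t', q', -, rfl, rfl⟩ := h
  exact ⟨t'.2, q'.2⟩

theorem Run.mem_of_extend_head {t q : ZFSet.{u}} (h : (R.extend X).head t q) :
    t ∈ M ∧ q ∈ M := by
  obtain ⟨t', q', -, rfl, rfl⟩ := h
  exact ⟨t'.2, q'.2⟩

theorem Run.mem_of_extend_tape {t ξ i : ZFSet.{u}} (h : (R.extend X).tape t ξ i) (hξ : ξ ∈ M) :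
    t ∈ M ∧ i ∈ M := by
  obtain ⟨t', ξ', i', -, rfl, rfl, rfl⟩ | ⟨-, h, -⟩ := h
  · exact ⟨t'.2, i'.2⟩
  · exact (h hξ).elim

variable (hM : IsTransitiveClass M)

include hM

theorem Run.extend_length_eq {b : M} (h : R.length = initialClass b) :
    (R.extend X).length = initialClass (b : ZFSet.{u}) := by
  ext t
  constructor
  · intro ht
    lift t to M using Run.mem_of_mem_extend_length ht
    rw [Run.extend_length_coe, h] at ht
    exact ordLE_coe.2 ht
  · intro ht
    lift t to M using hM.mem_of_ordLE ht
    rw [Run.extend_length_coe, h]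
    exact ordLE_coe.1 ht

theorem Run.hasInput_extend (hZ : ZFMinus M) (hX : IsTape X)
    (hRl : ∀ z, IsEmptySet z → z ∈ R.length) (hRX : HasInput R (restrictTape M X)) :
    HasInput (R.extend X) X := by
  obtain ⟨z, hz, h⟩ := hRX
  refine ⟨z, (isEmptySet_coe hM).2 hz, ?_⟩
  ext ξ i
  by_cases hξ : ξ ∈ M
  · lift ξ to M using hξ
    constructor
    · intro h'
      lift i to M using (Run.mem_of_extend_tape h' ξ.2).2
      rw [Run.extend_tape_coe, h] at h'
      exact h'
    · intro h'
      lift i to M using mem_of_isBit hM hZ (hX.1 _ _ h').2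
      rw [Run.extend_tape_coe, h]
      exact h'
  · rw [Run.extend_tape_of_not_mem hξ, Run.extend_length_coe]
    exact and_iff_right (hRl z hz)

variable (hZ : ZFMinus M) {P : Program} (hR : IsComputation P R) (hX : IsTape X)

include hZ hR hX

/-- A computation in `M` that stops extends to a computation in `V`: the head only visits cells in
`M`, so that the other cells keep their initial contents. -/
theorem IsComputation.extend {b : M} (hb : R.length = initialClass b) :
    IsComputation P (R.extend X) := by
  have hbl : b ∈ R.length := by rw [hb]; exact .inr rfl
  have hbo : IsOrd b := by
    rcases hR.length_eq with h | ⟨c, hc, h⟩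
    · rw [h] at hbl; exact hbl
    · rw [h] at hbl; exact hc.le hbl
  have htape : ∀ t ∈ (R.extend X).length, IsTape ((R.extend X).tape t) := by
    intro t ht
    lift t to M using Run.mem_of_mem_extend_length ht
    have hT := hR.tape_fun t (Run.extend_length_coe.1 ht)
    refine ⟨fun ξ i h => ?_, fun ξ hξ => ?_⟩
    · by_cases hξ : ξ ∈ M
      · lift ξ to M using hξ
        lift i to M using (Run.mem_of_extend_tape h ξ.2).2
        have h' := hT.1 _ _ (Run.extend_tape_coe.1 h)
        exact ⟨(isOrd_coe hM).2 h'.1, (isBit_coe hM).2 h'.2⟩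
      · exact hX.1 _ _ ((Run.extend_tape_of_not_mem hξ).1 h).2
    · by_cases hξM : ξ ∈ M
      · lift ξ to M using hξM
        obtain ⟨i, hi, hu⟩ := hT.2 ξ ((isOrd_coe hM).1 hξ)
        refine ⟨i, Run.extend_tape_coe.2 hi, fun j hj => ?_⟩
        lift j to M using (Run.mem_of_extend_tape hj ξ.2).2
        exact congrArg _ (hu j (Run.extend_tape_coe.1 hj))
      · simp only [Run.extend_tape_of_not_mem hξM, ht, true_and]
        exact hX.2 ξ hξ
  constructor
  · exact .inr ⟨b, (isOrd_coe hM).2 hbo, Run.extend_length_eq hM hb⟩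
  · refine ⟨fun t q h => ?_, fun t ht => ?_⟩
    · lift t to M using (Run.mem_of_extend_state h).1
      lift q to M using (Run.mem_of_extend_state h).2
      have h' := hR.state_fun.1 _ _ (Run.extend_state_coe.1 h)
      exact ⟨Run.extend_length_coe.2 h'.1, (isNat_coe hM).2 h'.2⟩
    · lift t to M using Run.mem_of_mem_extend_length ht
      obtain ⟨q, hq, hu⟩ := hR.state_fun.2 t (Run.extend_length_coe.1 ht)
      refine ⟨q, Run.extend_state_coe.2 hq, fun q' hq' => ?_⟩
      lift q' to M using (Run.mem_of_extend_state hq').2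
      exact congrArg _ (hu q' (Run.extend_state_coe.1 hq'))
  · refine ⟨fun t q h => ?_, fun t ht => ?_⟩
    · lift t to M using (Run.mem_of_extend_head h).1
      lift q to M using (Run.mem_of_extend_head h).2
      have h' := hR.head_fun.1 _ _ (Run.extend_head_coe.1 h)
      exact ⟨Run.extend_length_coe.2 h'.1, (isOrd_coe hM).2 h'.2⟩
    · lift t to M using Run.mem_of_mem_extend_length ht
      obtain ⟨q, hq, hu⟩ := hR.head_fun.2 t (Run.extend_length_coe.1 ht)
      refine ⟨q, Run.extend_head_coe.2 hq, fun q' hq' => ?_⟩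
      lift q' to M using (Run.mem_of_extend_head hq').2
      exact congrArg _ (hu q' (Run.extend_head_coe.1 hq'))
  · rintro t ξ i (⟨t', ξ', i', h, rfl, -, -⟩ | ⟨h, -⟩)
    · exact Run.extend_length_coe.2 (hR.tape_dom _ _ _ h)
    · exact h
  · exact htape
  · obtain ⟨z, hz, h, h'⟩ := hR.start
    exact ⟨z, (isEmptySet_coe hM).2 hz, Run.extend_state_coe.2 h, Run.extend_head_coe.2 h'⟩
  · intro t ht q hq hP
    lift t to M using Run.mem_of_mem_extend_length ht
    lift q to M using (Run.mem_of_extend_state hq).2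
    exact Run.extend_length_eq hM (hR.halt t (Run.extend_length_coe.1 ht) q
      (Run.extend_state_coe.1 hq) (mt (isStateOf_coe hM).2 hP))
  · intro t ht q hq hP
    lift t to M using Run.mem_of_mem_extend_length ht
    lift q to M using (Run.mem_of_extend_state hq).2
    obtain ⟨t', ht', hs, C, hC, x, x', h, h', hx, hx', hh, hh', hsrc, ⟨i, hi, hi'⟩, hT, htg, hmv⟩ :=
      hR.step t (Run.extend_length_coe.1 ht) q (Run.extend_state_coe.1 hq) ((isStateOf_coe hM).1 hP)
    have htl := Run.extend_length_coe (X := X).2 ht'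
    refine ⟨t', htl, (isSucc_coe hM).2 hs, C, hC, x, x', h, h',
      Run.extend_state_coe.2 hx, Run.extend_state_coe.2 hx', Run.extend_head_coe.2 hh,
      Run.extend_head_coe.2 hh', (isNumeral_coe hM).2 hsrc,
      ⟨i, Run.extend_tape_coe.2 hi, (isNumeral_coe hM).2 hi'⟩, fun ξ j => ?_,
      (isNumeral_coe hM).2 htg, (headMove_coe hM).2 hmv⟩
    by_cases hξ : ξ ∈ M
    · lift ξ to M using hξ
      by_cases hj : j ∈ M
      · lift j to M using hj
        rw [Run.extend_tape_coe, Run.extend_tape_coe, hT, isNumeral_coe hM, ← Subtype.ext_iff]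
        simp only [ne_eq, ← Subtype.ext_iff]
      · refine iff_of_false (fun h => hj (Run.mem_of_extend_tape h ξ.2).2) ?_
        rintro (⟨-, h⟩ | ⟨-, h⟩)
        · exact hj (mem_of_isNumeral hM hZ h)
        · exact hj (Run.mem_of_extend_tape h ξ.2).2
    · have hne : ξ ≠ h := fun e => hξ (e ▸ h.2)
      simp only [Run.extend_tape_of_not_mem hξ, htl, ht, hne, ne_eq, false_and, true_and,
        not_false_eq_true, false_or]
  · intro t ht hl ξ hξ i hi
    lift t to M using Run.mem_of_mem_extend_length ht
    have htl := Run.extend_length_coe.1 ht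
    have hlM := (isLimitOrd_coe hM).1 hl
    by_cases hξM : ξ ∈ M
    · lift ξ to M using hξM
      lift i to M using (Run.mem_of_extend_tape hi ξ.2).2
      exact (isLiminf_coe hM (F := fun r => (R.extend X).tape r ξ) (fun _ _ => Iff.rfl)
        (fun r _ x => Run.extend_tape_coe)
        fun r _ x hx => (Run.mem_of_extend_tape hx ξ.2).2).2
          (hR.tape_limit t htl hlM ξ ((isOrd_coe hM).1 hξ) i (Run.extend_tape_coe.1 hi))
    · have hXi := ((Run.extend_tape_of_not_mem hξM).1 hi).2
      refine IsLiminf.of_const (hX.1 _ _ hXi).2.isOrd hl.2.1 fun r hr x => ?_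
      have hrl : r ∈ (R.extend X).length := by
        lift r to M using hM t t.2 r hr
        exact Run.extend_length_coe.2 (hR.mem_of_le htl (.inl hr))
      rw [Run.extend_tape_of_not_mem hξM]
      exact ⟨fun h => (hX.2 ξ hξ).unique h.2 hXi, fun h => ⟨hrl, h ▸ hXi⟩⟩
  · intro t ht hl q hq
    lift t to M using Run.mem_of_mem_extend_length ht
    lift q to M using (Run.mem_of_extend_state hq).2
    exact (isLiminf_coe hM (fun _ _ => Iff.rfl) (fun r _ x => Run.extend_state_coe)
      fun r _ x hx => (Run.mem_of_extend_state hx).2).2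
        (hR.state_limit t (Run.extend_length_coe.1 ht) ((isLimitOrd_coe hM).1 hl) q
          (Run.extend_state_coe.1 hq))
  · intro t ht hl q h hq hh
    lift t to M using Run.mem_of_mem_extend_length ht
    lift q to M using (Run.mem_of_extend_state hq).2
    lift h to M using (Run.mem_of_extend_head hh).2
    exact (isLiminf_coe hM (C := fun s => (R.extend X).state s q) (C' := fun s => R.state s q)
      (fun _ _ => Run.extend_state_coe) (fun r _ x => Run.extend_head_coe)
      fun r _ x hx => (Run.mem_of_extend_head hx).2).2
        (hR.head_limit t (Run.extend_length_coe.1 ht) ((isLimitOrd_coe hM).1 hl) q h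
          (Run.extend_state_coe.1 hq) (Run.extend_head_coe.1 hh))

end Extension

/-! ### Computations on characteristic functions -/

section Characteristic

variable {M : Set ZFSet.{u}} (hM : IsTransitiveClass M) (hZ : ZFMinus M) {P : Program} {x y : M}

include hM

theorem restrictTape_charFun : restrictTape M (charFun (x : ZFSet.{u})) = charFun x := by
  ext ξ i
  exact charFun_coe hM

include hZ

/-- A stopping computation in `M` extends to one in `V`, for arbitrary transitive `M`. -/
theorem computes_of_computesIn (h : ComputesIn M P (charFun x) (charFun y)) :
    Computes P (charFun (x : ZFSet.{u})) (charFun (y : ZFSet.{u})) := by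
  obtain ⟨R, ⟨-, hR, hRX⟩, b, hb, hl, hY⟩ := h
  have hX := isTape_charFun hM hZ (x : ZFSet.{u})
  have hbl : b ∈ R.length := by rw [hl]; exact .inr rfl
  have hz : ∀ z, IsEmptySet z → z ∈ R.length := fun z hz => by
    have := hM.wfExt
    rw [hl]
    exact hz.isOrd.le_of_not_mem hb (hz b)
  refine ⟨R.extend (charFun (x : ZFSet.{u})), hR.extend hM hZ hX hl,
    Run.hasInput_extend hM hZ hX hz (by rwa [restrictTape_charFun hM]), b, (isOrd_coe hM).2 hb,
    Run.extend_length_eq hM hl, ?_⟩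
  ext ξ i
  by_cases hξ : ξ ∈ M
  · lift ξ to M using hξ
    constructor
    · intro h
      lift i to M using (Run.mem_of_extend_tape h ξ.2).2
      rw [Run.extend_tape_coe, hY] at h
      exact (charFun_coe hM).2 h
    · intro h
      lift i to M using mem_of_isBit hM hZ ((isTape_charFun hM hZ _).1 _ _ h).2
      rw [Run.extend_tape_coe, hY]
      exact (charFun_coe hM).1 h
  · -- Neither `x` nor `y` has elements outside `M`, so both characteristic functions are `0` there.
    have hx : ξ ∉ (x : ZFSet.{u}) := fun h => hξ (hM x x.2 ξ h)
    have hy : ξ ∉ (y : ZFSet.{u}) := fun h => hξ (hM y y.2 ξ h)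
    rw [Run.extend_tape_of_not_mem hξ, Run.extend_length_coe, and_iff_right hbl]
    simp [charFun, hx, hy]

theorem computesIn_of_computes (hOrd : ∀ a : ZFSet.{u}, a.IsOrdinal → a ∈ M)
    (h : Computes P (charFun (x : ZFSet.{u})) (charFun (y : ZFSet.{u}))) :
    ComputesIn M P (charFun x) (charFun y) := by
  obtain ⟨R, hR, hRX, b, hb, hl, hY⟩ := h
  lift b to M using hOrd b hb.isOrdinal
  refine ⟨R.restrict M, ?_, b, (isOrd_coe hM).1 hb, ?_, ?_⟩
  · rw [← restrictTape_charFun hM]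
    refine hR.isComputationIn_restrict hM hZ hRX ?_
    rw [restrictTape_charFun hM]
    exact (DefPred.charFun x).out
  · ext t
    simp only [Run.restrict, hl, initialClass, Set.mem_ofPred_eq, ordLE_coe]
  · rw [← restrictTape_charFun hM, ← hY]
    rfl

end Characteristic

end OrdinalMachine

open OrdinalMachine
theorem mainTheorem6 (M : Set ZFSet.{u}) (hM : IsTransitiveClass M) (hZF : ZFMinus M)
    (P : Program) :
    -- parts (a) and (b)
    (∀ T₀ : ZFSet.{u} → ZFSet.{u} → Prop, IsTape T₀ →
      IsDefinable {v : Fin 2 → M | restrictTape M T₀ (v 0) (v 1)} →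
      ∀ R : Run ZFSet.{u}, IsComputation P R → HasInput R T₀ →
        (IsComputationIn M P (restrictTape M T₀) (R.restrict M) ∧
          ∀ R' : Run M, IsComputationIn M P (restrictTape M T₀) R' → R' = R.restrict M) ∧
        ((∀ a : ZFSet.{u}, a.IsOrdinal → a ∈ M) →
          ∀ R' : Run M, IsComputationIn M P (restrictTape M T₀) R' → R'.toUniverse = R)) ∧
    -- part (c)
    ((∀ a : ZFSet.{u}, a.IsOrdinal → a ∈ M) →
      ∀ x y : M, (∀ a ∈ (x : ZFSet.{u}), a.IsOrdinal) → (∀ a ∈ (y : ZFSet.{u}), a.IsOrdinal) →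
        (Computes P (charFun (x : ZFSet.{u})) (charFun (y : ZFSet.{u})) ↔
          ComputesIn M P (charFun x) (charFun y))) ∧
    -- part (d)
    (∀ x y : M, (∀ a ∈ (x : ZFSet.{u}), a.IsOrdinal) → (∀ a ∈ (y : ZFSet.{u}), a.IsOrdinal) →
      ComputesIn M P (charFun x) (charFun y) →
        Computes P (charFun (x : ZFSet.{u})) (charFun (y : ZFSet.{u}))) := by
  have := hM.wfExt
  refine ⟨fun T₀ _ hd R hR hRX => ?_, fun hOrd x y _ _ => ?_, fun x y _ _ => ?_⟩
  · have hin := hR.isComputationIn_restrict hM hZF hRX hd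
    have huniq : ∀ R' : Run M, IsComputationIn M P (restrictTape M T₀) R' → R' = R.restrict M :=
      fun R' hR' => hR'.2.1.unique hin.2.1 hR'.2.2 hin.2.2
    exact ⟨⟨hin, huniq⟩, fun hOrd R' hR' => huniq R' hR' ▸ hR.toUniverse_restrict hOrd⟩
  · exact ⟨computesIn_of_computes hM hZF hOrd, computes_of_computesIn hM hZF⟩
  · exact computes_of_computesIn hM hZF
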